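/- Young diagrams are drawn in English notation. For Young diagrams $\lambda\subseteq\nu$, let $\mathrm{INC}(\nu/\lambda)$ be the set of increasing tableaux of shape $\nu/\lambda$, i.e. fillings of the boxes of $\nu\setminus\lambda$ by positive integers that strictly increase along rows (left to right) and down columns; write $\mathrm{INC}(\mu)=\mathrm{INC}(\mu/\emptyset)$. An inner corner of $T\in\mathrm{INC}(\nu/\lambda)$ is a maximally southeast box of $\lambda$. Given a nonempty set $X$ of inner corners, the slide $K\mathrm{jdt}_X(T)$ is obtained as follows. Put a symbol $\bullet$ in each box of $X$. Then, for $k=1,2,\dots$ up to the largest label of $T$, consider the edge-connected components of the set of boxes containing $\bullet$ or $k$; in each component with at least two boxes exchange the two symbols $\bullet$ and $k$, and leave one-box components unchanged. Finally delete all $\bullet$'s. The result is an increasing tableau of shape $\nu'/(\lambda\setminus X)$ for some $\nu'\subseteq\nu$. A rectification order is a choice of successive slides, each into a nonempty set of inner corners of the current tableau, continued until the inner shape is empty; the resulting tableau is called a $K$-rectification of $T$. **Theorem.** Let $\nu$ be a Young diagram and let $R=a\times b\subseteq\nu$ be a rectangle. (I) If $T\in\mathrm{INC}(\nu/R)$,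 then the $K$-rectification of $T$ is independent of the rectification order: there are a Young diagram $\mu$ and a tableau $K\mathrm{rect}(T)\in\mathrm{INC}(\mu)$ such that every rectification order for $T$ results in $K\mathrm{rect}(T)$. (II) For every Young diagram $\mu$, the number of tableaux $T\in\mathrm{INC}(\nu/R)$ with $K\mathrm{rect}(T)=C$ is finite and is the same for all $C\in\mathrm{INC}(\mu)$. -/

import Mathlib

/-- The content of a position of the plane: nothing, a bullet, or a numerical label. -/
inductive Box where
  | empty : Box
  | bullet : Box
  | label (n : ℕ) : Box

/-- Fillings of positions `(i, j)` (row `i` from the top, column `j` from the left). -/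
abbrev Filling := ℕ × ℕ → Box

/-- `INC(ν/lam)`: the fillings of the boxes of `ν` outside `lam` (and of no other position) by
positive integers, strictly increasing along rows and down columns. The straight shape case is
`INC(μ) = INC μ ⊥`. -/
def INC (ν lam : YoungDiagram) : Set Filling :=
  {T | (∀ c, c ∈ ν → c ∉ lam → ∃ n, 1 ≤ n ∧ T c = Box.label n) ∧
       (∀ c, ¬ (c ∈ ν ∧ c ∉ lam) → T c = Box.empty) ∧
       (∀ i j₁ j₂ m n, j₁ < j₂ → T (i, j₁) = Box.label m → T (i, j₂) = Box.label n → m < n) ∧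
       (∀ i₁ i₂ j m n, i₁ < i₂ → T (i₁, j) = Box.label m → T (i₂, j) = Box.label n → m < n)}

/-- The `a × b` rectangle (`a` rows, `b` columns). -/
def rectangle (a b : ℕ) : YoungDiagram where
  cells := Finset.range a ×ˢ Finset.range b
  isLowerSet := by
    rintro ⟨i, j⟩ ⟨i', j'⟩ ⟨hi, hj⟩ h
    simp only [Finset.coe_product, Finset.coe_range, Set.mem_prod, Set.mem_Iio] at h ⊢
    exact ⟨lt_of_le_of_lt hi h.1, lt_of_le_of_lt hj h.2⟩

/-- Two positions share an edge. -/
def AdjBoxes (c d : ℕ × ℕ) : Prop :=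
  (c.1 = d.1 ∧ (c.2 + 1 = d.2 ∨ d.2 + 1 = c.2)) ∨
  (c.2 = d.2 ∧ (c.1 + 1 = d.1 ∨ d.1 + 1 = c.1))

/-- Exchange of the two symbols `•` and `k`. -/
def toggle (k : ℕ) : Box → Box
  | Box.empty => Box.empty
  | Box.bullet => Box.label k
  | Box.label n => if n = k then Box.bullet else Box.label n

open Classical in
/-- `switch` applied to the union of the ribbons made of the boxes containing `•` or `k`.
These ribbons are the connected components of the set of such boxes; in a component with at least
two boxes every symbol is exchanged with the other one, while a one-box component (a box none of
whose neighbours contains `•` or `k`) is left alone. -/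
noncomputable def switch (k : ℕ) (T : Filling) : Filling := fun c =>
  if (T c = Box.bullet ∨ T c = Box.label k) ∧
      ∃ d, AdjBoxes c d ∧ (T d = Box.bullet ∨ T d = Box.label k) then
    toggle k (T c)
  else T c

/-- Apply `switch` for the labels `1, 2, …, N`, in this order. -/
noncomputable def switchUpTo (T : Filling) : ℕ → Filling
  | 0 => T
  | N + 1 => switch (N + 1) (switchUpTo T N)

/-- The largest label of a filling (`0` if there is none). -/
noncomputable def maxLabel (T : Filling) : ℕ := sSup {n | ∃ c, T c = Box.label n}

open Classical in
/-- Put a bullet into every box of `X`. -/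
noncomputable def addBullets (X : Finset (ℕ × ℕ)) (T : Filling) : Filling := fun c =>
  if c ∈ X then Box.bullet else T c

/-- Delete all bullets, keeping the numerical labels. -/
def eraseBullets (T : Filling) : Filling := fun c =>
  match T c with
  | Box.bullet => Box.empty
  | x => x

/-- The slide `Kjdt_X(T)`. -/
noncomputable def Kjdt (X : Finset (ℕ × ℕ)) (T : Filling) : Filling :=
  eraseBullets (switchUpTo (addBullets X T) (maxLabel T))

/-- An inner corner of `lam` (for a tableau of shape `ν/lam`): a maximally southeast box of `lam`. -/
def IsInnerCorner (lam : YoungDiagram) (c : ℕ × ℕ) : Prop :=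
  c ∈ lam ∧ (c.1 + 1, c.2) ∉ lam ∧ (c.1, c.2 + 1) ∉ lam

/-- `KRectifiesTo lam T C`: for a tableau `T` of shape `ν/lam`, some sequence of `Kjdt` slides, each
into a non-empty set of inner corners, continued until there are no inner corners left, turns `T`
into `C`. A slide into `X` removes `X` from the inner shape. -/
inductive KRectifiesTo : YoungDiagram → Filling → Filling → Prop
  | done (T : Filling) : KRectifiesTo ⊥ T T
  | slide (lam lam' : YoungDiagram) (X : Finset (ℕ × ℕ)) (T C : Filling)
      (hne : X.Nonempty) (hX : ∀ c ∈ X, IsInnerCorner lam c)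
      (hlam' : lam'.cells = lam.cells \ X)
      (h : KRectifiesTo lam' (Kjdt X T) C) : KRectifiesTo lam T C

/-! Independence. Call the boxes that hold a bullet at some time of a slide its track. After a slide
into a box d, the regions on the two sides of the track are `Guarded`: if a later bullet in such a
region touches a labelled box outside it, then its other neighbour lies inside and has a smaller
label, so the bullet is filled from inside first. Hence slides into corners on opposite sides of the
track do not interact: they commute, and the simultaneous slide is their composite
(`IsSlide.Kjdt_union`). Between two corners of an inner shape contained in R there is a box d of R
that can be added to that shape; this is where R must be a rectangle. By induction on the number of
vacated boxes of R, the current tableau does not depend on the earlier slides, so it may be regarded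
as the outcome of a slide into d, and this slide separates the two corners (`Kjdt_split`). So all
choices of the last slide agree (`Reach.unique`).

Counting. Let the outer shape be a rectangle Λ with A more rows and B more columns than R. The same
barriers force the slide into d to end exactly at d + (A, B) (`Reach.mem_INC_outerShape`). Since the
final bullets are known and every `switch` is an involution, slides can be undone, so rectification
is injective on INC(Λ/R). All results have the same shape, the half turn of Λ/R. Rotation with
complemented labels embeds the tableaux of that shape with labels at most N into those of shape Λ/R;
followed by rectification, it is an injective self-map of a finite set. So rectification is also
surjective (`exists_reach_eq`).

For general ν, cut at a threshold n. Rectifying the labels at most n gives the labels at most n of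
the rectification (`KRectifiesTo.keep`), and for outer shape Λ the labels above n of the
rectification determine those of the original (`label_iff_of_reach`). Choose Λ containing ν and
extend each T that rectifies to C by one fixed tableau F of shape Λ/ν with labels above n. Rectify,
exchange C for C', and undo the rectification: the large labels are again F, and the small ones form
a tableau of shape ν/R that rectifies to C'. This is injective, and C and C' play symmetric roles.
-/

/-! ### The run of a slide -/

/-- `d` is the right or the lower neighbour of `c`. -/
def NextBox (c d : ℕ × ℕ) : Prop := d = (c.1 + 1, c.2) ∨ d = (c.1, c.2 + 1)

theorem adjBoxes_iff {c d : ℕ × ℕ} : AdjBoxes c d ↔ NextBox c d ∨ NextBox d c := by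
  obtain ⟨a, b⟩ := c
  obtain ⟨a', b'⟩ := d
  simp only [AdjBoxes, NextBox, Prod.mk.injEq]
  omega

theorem NextBox.le {c d : ℕ × ℕ} (h : NextBox c d) : c ≤ d := by
  rcases h with rfl | rfl <;> simp [Prod.le_def]

theorem NextBox.mem {lam : YoungDiagram} {c d : ℕ × ℕ} (h : NextBox c d) (hd : d ∈ lam) :
    c ∈ lam :=
  lam.isLowerSet h.le hd

theorem IsInnerCorner.notMem {lam : YoungDiagram} {c d : ℕ × ℕ} (hc : IsInnerCorner lam c)
    (h : NextBox c d) : d ∉ lam := by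
  rcases h with rfl | rfl
  exacts [hc.2.1, hc.2.2]

/-- The inner shape `lam'` arises from `lam` by removing the set `X` of inner corners. -/
structure IsRemoval (lam lam' : YoungDiagram) (X : Finset (ℕ × ℕ)) : Prop where
  corner : ∀ c ∈ X, IsInnerCorner lam c
  cells : lam'.cells = lam.cells \ X

theorem IsRemoval.mem_iff {lam lam' : YoungDiagram} {X : Finset (ℕ × ℕ)}
    (h : IsRemoval lam lam' X) {c : ℕ × ℕ} : c ∈ lam' ↔ c ∈ lam ∧ c ∉ X := by
  rw [← YoungDiagram.mem_cells, h.cells, Finset.mem_sdiff, YoungDiagram.mem_cells]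

theorem IsRemoval.le {lam lam' : YoungDiagram} {X : Finset (ℕ × ℕ)}
    (h : IsRemoval lam lam' X) : lam' ≤ lam := fun _ hc => (h.mem_iff.1 hc).1

/-- Any set of inner corners can be removed. -/
theorem exists_isRemoval {lam : YoungDiagram} {X : Finset (ℕ × ℕ)}
    (hX : ∀ c ∈ X, IsInnerCorner lam c) : ∃ lam', IsRemoval lam lam' X := by
  refine ⟨⟨lam.cells \ X, ?_⟩, hX, rfl⟩
  intro c d hdc hc
  simp only [Finset.coe_sdiff, Set.mem_sdiff, Finset.mem_coe, YoungDiagram.mem_cells] at hc ⊢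
  refine ⟨lam.isLowerSet hdc hc.1, fun hd => ?_⟩
  have hcd := hX d hd
  by_cases h1 : d.1 < c.1
  · exact hcd.2.1 (lam.isLowerSet (show (d.1 + 1, d.2) ≤ c from ⟨h1, hdc.2⟩) hc.1)
  by_cases h2 : d.2 < c.2
  · exact hcd.2.2 (lam.isLowerSet (show (d.1, d.2 + 1) ≤ c from ⟨hdc.1, h2⟩) hc.1)
  have : d = c := Prod.ext (le_antisymm hdc.1 (not_lt.1 h1)) (le_antisymm hdc.2 (not_lt.1 h2))
  exact hc.2 (this ▸ hd)

/-- The position of a symbol in the order at the moment when the labels up to `k` have been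
processed: the bullets come right after the label `k`. -/
def Box.rank (k : ℕ) : Box → ℕ
  | Box.empty => 0
  | Box.bullet => 2 * k + 1
  | Box.label n => 2 * n

/-- The fillings of `ν/lam` by labels and bullets that occur during a slide, after the labels up to
`k` have been processed. -/
structure IsState (ν lam : YoungDiagram) (k : ℕ) (s : Filling) : Prop where
  supp : ∀ c, s c ≠ Box.empty ↔ c ∈ ν ∧ c ∉ lam
  pos : ∀ c n, s c = Box.label n → 1 ≤ n
  lt : ∀ c d, NextBox c d → s c ≠ Box.empty → s d ≠ Box.empty →
    (s c).rank k < (s d).rank k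

theorem switch_of_ne {k : ℕ} {s : Filling} {c : ℕ × ℕ} (h : s c ≠ Box.bullet)
    (h' : s c ≠ Box.label k) : switch k s c = s c := by
  simp [switch, h, h']

theorem switch_bullet_or {k : ℕ} {s : Filling} {c : ℕ × ℕ} :
    (switch k s c = Box.bullet ∨ switch k s c = Box.label k) ↔
      (s c = Box.bullet ∨ s c = Box.label k) := by
  unfold switch
  split_ifs with h
  · rcases h.1 with h1 | h1 <;> simp [h1, toggle]
  · rfl

/-- The set of boxes containing • or k is the same before and after, hence so are its components.
This is what makes slides reversible. -/
theorem switch_switch (k : ℕ) (s : Filling) : switch k (switch k s) = s := by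
  funext c
  by_cases h : (s c = Box.bullet ∨ s c = Box.label k) ∧
      ∃ d, AdjBoxes c d ∧ (s d = Box.bullet ∨ s d = Box.label k)
  · have h' : (switch k s c = Box.bullet ∨ switch k s c = Box.label k) ∧
      ∃ d, AdjBoxes c d ∧ (switch k s d = Box.bullet ∨ switch k s d = Box.label k) := by
      simpa only [switch_bullet_or] using h
    have e : switch k s c = toggle k (s c) := by rw [switch, if_pos h]
    rw [switch, if_pos h', e]
    rcases h.1 with h1 | h1 <;> simp [h1, toggle]
  · have h' : ¬ ((switch k s c = Box.bullet ∨ switch k s c = Box.label k) ∧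
      ∃ d, AdjBoxes c d ∧ (switch k s d = Box.bullet ∨ switch k s d = Box.label k)) := by
      simpa only [switch_bullet_or] using h
    rw [switch, if_neg h', switch, if_neg h]

theorem switch_eq_label_of_ne {k v : ℕ} {s : Filling} {c : ℕ × ℕ} (h : k ≠ v) :
    switch k s c = Box.label v ↔ s c = Box.label v := by
  by_cases h1 : s c = Box.bullet ∨ s c = Box.label k
  · have h2 := switch_bullet_or.2 h1
    constructor
    · intro h3; rw [h3] at h2; simp [h.symm] at h2
    · intro h3; rw [h3] at h1; simp [h.symm] at h1
  · push Not at h1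
    rw [switch_of_ne h1.1 h1.2]

theorem switch_eq_empty {k : ℕ} {s : Filling} {c : ℕ × ℕ} :
    switch k s c = Box.empty ↔ s c = Box.empty := by
  by_cases h1 : s c = Box.bullet ∨ s c = Box.label k
  · have h2 := switch_bullet_or.2 h1
    constructor
    · intro h3; rw [h3] at h2; simp at h2
    · intro h3; rw [h3] at h1; simp at h1
  · push Not at h1
    rw [switch_of_ne h1.1 h1.2]

/-! ### One step of a slide -/

namespace IsState

variable {ν lam : YoungDiagram} {k : ℕ} {s : Filling}

/-- The bullet ranks strictly between k and k + 1, and ranks increase strictly. So two bullets are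
never neighbours, and k + 1 can only be to the right of or below a bullet. -/
theorem bullet_next (h : IsState ν lam k s) {c d : ℕ × ℕ} (hcd : AdjBoxes c d)
    (hc : s c = Box.bullet) (hd : s d = Box.bullet ∨ s d = Box.label (k + 1)) :
    NextBox c d ∧ s d = Box.label (k + 1) := by
  rcases adjBoxes_iff.1 hcd with h1 | h1
  · have := h.lt c d h1 (by simp [hc]) (by rcases hd with hd | hd <;> simp [hd])
    rcases hd with hd | hd
    · simp [hc, hd, Box.rank] at this
    · exact ⟨h1, hd⟩
  · have := h.lt d c h1 (by rcases hd with hd | hd <;> simp [hd]) (by simp [hc])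
    rcases hd with hd | hd <;> simp [hc, hd, Box.rank] at this

theorem label_prev (h : IsState ν lam k s) {c d : ℕ × ℕ} (hcd : AdjBoxes c d)
    (hc : s c = Box.label (k + 1)) (hd : s d = Box.bullet ∨ s d = Box.label (k + 1)) :
    NextBox d c ∧ s d = Box.bullet := by
  rcases adjBoxes_iff.1 hcd with h1 | h1
  · have := h.lt c d h1 (by simp [hc]) (by rcases hd with hd | hd <;> simp [hd])
    rcases hd with hd | hd <;> simp [hc, hd, Box.rank] at this
  · have := h.lt d c h1 (by rcases hd with hd | hd <;> simp [hd]) (by simp [hc])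
    rcases hd with hd | hd
    · exact ⟨h1, hd⟩
    · simp [hc, hd, Box.rank] at this

/-- A bullet is filled exactly when the label that is being processed is next to it. -/
theorem switch_bullet (h : IsState ν lam k s) {c : ℕ × ℕ} (hc : s c = Box.bullet) :
    (switch (k + 1) s c = Box.label (k + 1) ∧ ∃ d, NextBox c d ∧ s d = Box.label (k + 1)) ∨
    (switch (k + 1) s c = Box.bullet ∧ ∀ d, NextBox c d → s d ≠ Box.label (k + 1)) := by
  unfold switch
  split_ifs with h1
  · left
    obtain ⟨d, hd, hd'⟩ := h1.2
    exact ⟨by simp [hc, toggle], d, h.bullet_next hd hc hd'⟩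
  · right
    refine ⟨hc, fun d hd hd' => h1 ⟨Or.inl hc, d, adjBoxes_iff.2 (Or.inl hd), Or.inr hd'⟩⟩

theorem switch_label (h : IsState ν lam k s) {c : ℕ × ℕ} (hc : s c = Box.label (k + 1)) :
    (switch (k + 1) s c = Box.bullet ∧ ∃ d, NextBox d c ∧ s d = Box.bullet) ∨
    (switch (k + 1) s c = Box.label (k + 1) ∧ ∀ d, NextBox d c → s d ≠ Box.bullet) := by
  unfold switch
  split_ifs with h1
  · left
    obtain ⟨d, hd, hd'⟩ := h1.2
    exact ⟨by simp [hc, toggle], d, h.label_prev hd hc hd'⟩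
  · right
    refine ⟨hc, fun d hd hd' => h1 ⟨Or.inr hc, d, adjBoxes_iff.2 (Or.inr hd), Or.inl hd'⟩⟩

theorem rank_switch_cases (h : IsState ν lam k s) {c : ℕ × ℕ} (hc : s c ≠ Box.empty) :
    ((s c).rank k ≤ 2 * k ∧ (switch (k + 1) s c).rank (k + 1) ≤ 2 * k) ∨
    (s c = Box.bullet ∧ 2 * k + 2 ≤ (switch (k + 1) s c).rank (k + 1) ∧
      (switch (k + 1) s c).rank (k + 1) ≤ 2 * k + 3) ∨
    (s c = Box.label (k + 1) ∧ 2 * k + 2 ≤ (switch (k + 1) s c).rank (k + 1) ∧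
      (switch (k + 1) s c).rank (k + 1) ≤ 2 * k + 3) ∨
    (2 * k + 4 ≤ (s c).rank k ∧ 2 * k + 4 ≤ (switch (k + 1) s c).rank (k + 1)) := by
  match hs : s c with
  | Box.empty => exact absurd hs hc
  | Box.bullet =>
    rcases h.switch_bullet hs with ⟨h1, -⟩ | ⟨h1, -⟩ <;> simp [h1, Box.rank] <;> omega
  | Box.label n =>
    by_cases hn : n = k + 1
    · subst hn
      rcases h.switch_label hs with ⟨h1, -⟩ | ⟨h1, -⟩ <;> simp [h1, Box.rank] <;> omega
    · rw [switch_of_ne (by simp [hs]) (by simpa [hs] using hn), hs]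
      simp only [Box.rank]
      simp
      omega

/-- The step changes only • and k + 1, whose ranks 2k + 1 and 2k + 2 stay in a window between the
untouched ranks: at most 2k below, at least 2k + 4 above. -/
theorem switch (h : IsState ν lam k s) : IsState ν lam (k + 1) (switch (k + 1) s) where
  supp c := by rw [ne_eq, switch_eq_empty]; exact h.supp c
  pos c n hc := by
    by_cases hn : k + 1 = n
    · omega
    · exact h.pos c n ((switch_eq_label_of_ne hn).1 hc)
  lt c d hcd hc hd := by
    rw [ne_eq, switch_eq_empty] at hc hd
    have hlt := h.lt c d hcd hc hd
    have h1 := h.rank_switch_cases hc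
    have h2 := h.rank_switch_cases hd
    -- The only neighbours that can both lie in the window: the symbols are exchanged, and the
    -- bullet now ranks after k + 1.
    by_cases hx : s c = Box.bullet ∧ s d = Box.label (k + 1)
    · have e1 : _root_.switch (k + 1) s c = Box.label (k + 1) := by
        rcases h.switch_bullet hx.1 with h3 | h3
        · exact h3.1
        · exact absurd hx.2 (h3.2 d hcd)
      have e2 : _root_.switch (k + 1) s d = Box.bullet := by
        rcases h.switch_label hx.2 with h3 | h3
        · exact h3.1
        · exact absurd hx.1 (h3.2 c hcd)
      simp [e1, e2, Box.rank]
    · by_cases hmono : 2 * k + 4 ≤ (s d).rank k ∧ 2 * k + 4 ≤ (s c).rank k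
      · have hu : ∀ e, 2 * k + 4 ≤ (s e).rank k →
            (_root_.switch (k + 1) s e).rank (k + 1) = (s e).rank k := by
          intro e he
          match hs : s e with
          | Box.empty => simp [hs, Box.rank] at he
          | Box.bullet => simp [hs, Box.rank] at he
          | Box.label n =>
            simp only [hs, Box.rank] at he
            rw [switch_of_ne (by simp [hs]) (by simp [hs]; omega), hs]; rfl
        rw [hu _ hmono.1, hu _ hmono.2]; exact hlt
      · by_cases hmono' : (s d).rank k ≤ 2 * k ∧ (s c).rank k ≤ 2 * k
        · have hu : ∀ e, s e ≠ Box.empty → (s e).rank k ≤ 2 * k →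
            (_root_.switch (k + 1) s e).rank (k + 1) = (s e).rank k := by
            intro e hne he
            match hs : s e with
            | Box.empty => exact absurd hs hne
            | Box.bullet => simp [hs, Box.rank] at he
            | Box.label n =>
              simp only [hs, Box.rank] at he
              rw [switch_of_ne (by simp [hs]) (by simp [hs]; omega), hs]; rfl
          rw [hu _ hd hmono'.1, hu _ hc hmono'.2]; exact hlt
        -- The two boxes now belong to different rank ranges, up to cases excluded by `hlt` or `hx`.
        · rcases h1 with h1 | h1 | h1 | h1 <;> rcases h2 with h2 | h2 | h2 | h2 <;>
            first
            | omega
            | (simp only [h1.1, h2.1, Box.rank] at hlt; omega)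
            | exact absurd ⟨h1.1, h2.1⟩ hx

end IsState

/-- The filling obtained from `T` with bullets in `X` after processing the labels up to `k`. -/
noncomputable def run (X : Finset (ℕ × ℕ)) (T : Filling) (k : ℕ) : Filling :=
  switchUpTo (addBullets X T) k

theorem run_succ (X : Finset (ℕ × ℕ)) (T : Filling) (k : ℕ) :
    run X T (k + 1) = switch (k + 1) (run X T k) := rfl

theorem run_zero_of_mem {X : Finset (ℕ × ℕ)} {T : Filling} {c : ℕ × ℕ} (h : c ∈ X) :
    run X T 0 c = Box.bullet := by simp [run, switchUpTo, addBullets, h]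

theorem run_zero_of_notMem {X : Finset (ℕ × ℕ)} {T : Filling} {c : ℕ × ℕ} (h : c ∉ X) :
    run X T 0 c = T c := by simp [run, switchUpTo, addBullets, h]

/-! ### Increasing tableaux and states -/

theorem INC.label_iff {ν lam : YoungDiagram} {T : Filling} (hT : T ∈ INC ν lam) {c : ℕ × ℕ} :
    (∃ n, T c = Box.label n) ↔ c ∈ ν ∧ c ∉ lam := by
  constructor
  · rintro ⟨n, hn⟩
    by_contra h
    rw [hT.2.1 c h] at hn
    cases hn
  · intro h
    obtain ⟨n, -, hn⟩ := hT.1 c h.1 h.2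
    exact ⟨n, hn⟩

theorem INC.pos {ν lam : YoungDiagram} {T : Filling} (hT : T ∈ INC ν lam) {c : ℕ × ℕ} {n : ℕ}
    (h : T c = Box.label n) : 1 ≤ n := by
  obtain ⟨h1, h2⟩ := (INC.label_iff hT).1 ⟨n, h⟩
  obtain ⟨m, hm, hm'⟩ := hT.1 c h1 h2
  rw [h] at hm'
  cases hm'
  exact hm

theorem INC.ne_bullet {ν lam : YoungDiagram} {T : Filling} (hT : T ∈ INC ν lam) (c : ℕ × ℕ) :
    T c ≠ Box.bullet := by
  intro h
  by_cases hc : c ∈ ν ∧ c ∉ lam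
  · obtain ⟨n, hn⟩ := (INC.label_iff hT).2 hc
    rw [h] at hn; cases hn
  · rw [hT.2.1 c hc] at h; cases h

theorem INC.lt {ν lam : YoungDiagram} {T : Filling} (hT : T ∈ INC ν lam) {c d : ℕ × ℕ}
    {m n : ℕ} (h : NextBox c d) (hc : T c = Box.label m) (hd : T d = Box.label n) : m < n := by
  obtain ⟨i, j⟩ := c
  rcases h with rfl | rfl
  · exact hT.2.2.2 i (i + 1) j m n (by omega) hc hd
  · exact hT.2.2.1 i j (j + 1) m n (by omega) hc hd

/-- It suffices to compare neighbouring boxes. -/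
theorem mem_INC_of_next {ν lam : YoungDiagram} {T : Filling}
    (h1 : ∀ c, c ∈ ν → c ∉ lam → ∃ n, 1 ≤ n ∧ T c = Box.label n)
    (h2 : ∀ c, ¬ (c ∈ ν ∧ c ∉ lam) → T c = Box.empty)
    (h3 : ∀ c d m n, NextBox c d → T c = Box.label m → T d = Box.label n → m < n) :
    T ∈ INC ν lam := by
  have key : ∀ c n, T c = Box.label n → c ∈ ν ∧ c ∉ lam := fun c n hc => by
    by_contra h
    rw [h2 c h] at hc
    cases hc
  refine ⟨h1, h2, ?_, ?_⟩
  · intro i j₁ j₂ m n hj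
    induction j₂, hj using Nat.le_induction generalizing n with
    | base => exact h3 _ _ m n (Or.inr rfl)
    | succ j hj ih =>
      intro hm hn
      have a := (key _ _ hm).2
      have b := (key _ _ hn).1
      obtain ⟨p, -, hp⟩ := h1 (i, j) (ν.isLowerSet (show (i, j) ≤ (i, j + 1) by simp) b)
        (fun hh => a (lam.isLowerSet (show (i, j₁) ≤ (i, j) from ⟨le_rfl, by simp; omega⟩) hh))
      exact (ih p hm hp).trans (h3 _ _ _ _ (Or.inr rfl) hp hn)
  · intro i₁ i₂ j m n hj
    induction i₂, hj using Nat.le_induction generalizing n with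
    | base => exact h3 _ _ m n (Or.inl rfl)
    | succ i hi ih =>
      intro hm hn
      have a := (key _ _ hm).2
      have b := (key _ _ hn).1
      obtain ⟨p, -, hp⟩ := h1 (i, j) (ν.isLowerSet (show (i, j) ≤ (i + 1, j) by simp) b)
        (fun hh => a (lam.isLowerSet (show (i₁, j) ≤ (i, j) from ⟨by simp; omega, le_rfl⟩) hh))
      exact (ih p hm hp).trans (h3 _ _ _ _ (Or.inl rfl) hp hn)

theorem INC.exists_bound {ν lam : YoungDiagram} {T : Filling} (hT : T ∈ INC ν lam) :
    BddAbove {n | ∃ c, T c = Box.label n} := by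
  have : {n | ∃ c, T c = Box.label n} ⊆
      (fun c => match T c with | Box.label n => n | _ => 0) '' (ν.cells : Set (ℕ × ℕ)) := by
    rintro n ⟨c, hc⟩
    refine ⟨c, ((INC.label_iff hT).1 ⟨n, hc⟩).1, ?_⟩
    simp [hc]
  exact (ν.cells.finite_toSet.image _).bddAbove.mono this

theorem INC.le_maxLabel {ν lam : YoungDiagram} {T : Filling} (hT : T ∈ INC ν lam) {c : ℕ × ℕ}
    {n : ℕ} (h : T c = Box.label n) : n ≤ maxLabel T :=
  le_csSup (INC.exists_bound hT) ⟨c, h⟩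

theorem isState_zero {ν lam lam' : YoungDiagram} {T : Filling} {X : Finset (ℕ × ℕ)}
    (hT : T ∈ INC ν lam) (hle : lam ≤ ν) (hX : IsRemoval lam lam' X) :
    IsState ν lam' 0 (run X T 0) where
  supp c := by
    by_cases hc : c ∈ X
    · have := (hX.corner c hc).1
      simp [run_zero_of_mem hc, hX.mem_iff, hc, hle this]
    · rw [run_zero_of_notMem hc, hX.mem_iff]
      have := INC.label_iff hT (c := c)
      have h2 := hT.2.1 c
      constructor
      · intro h
        by_contra h3
        exact h (h2 (by tauto))
      · intro h
        obtain ⟨n, hn⟩ := this.2 ⟨h.1, by tauto⟩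
        simp [hn]
  pos c n hc := by
    by_cases hx : c ∈ X
    · simp [run_zero_of_mem hx] at hc
    · rw [run_zero_of_notMem hx] at hc
      exact INC.pos hT hc
  lt c d hcd hc hd := by
    have key : ∀ e, e ∉ X → run X T 0 e ≠ Box.empty →
        ∃ n, 1 ≤ n ∧ run X T 0 e = Box.label n ∧ T e = Box.label n ∧ e ∉ lam := by
      intro e he hne
      rw [run_zero_of_notMem he] at hne ⊢
      have : e ∈ ν ∧ e ∉ lam := by
        by_contra h
        exact hne (hT.2.1 e h)
      obtain ⟨n, h1, h2⟩ := hT.1 e this.1 this.2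
      exact ⟨n, h1, h2, h2, this.2⟩
    by_cases hcX : c ∈ X
    · have h1 := (hX.corner c hcX).notMem hcd
      have hdX : d ∉ X := fun h => h1 (hX.corner d h).1
      obtain ⟨n, hn, hn', -⟩ := key d hdX hd
      rw [run_zero_of_mem hcX, hn']
      simp only [Box.rank]; omega
    · obtain ⟨m, hm, hm', hm'', hmn⟩ := key c hcX hc
      have hdX : d ∉ X := fun h => hmn (hcd.mem (hX.corner d h).1)
      obtain ⟨n, hn, hn', hn'', -⟩ := key d hdX hd
      rw [hm', hn']
      have := INC.lt hT hcd hm'' hn''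
      simp only [Box.rank]; omega

theorem isState_run {ν lam lam' : YoungDiagram} {T : Filling} {X : Finset (ℕ × ℕ)}
    (hT : T ∈ INC ν lam) (hle : lam ≤ ν) (hX : IsRemoval lam lam' X) (k : ℕ) :
    IsState ν lam' k (run X T k) := by
  induction k with
  | zero => exact isState_zero hT hle hX
  | succ k ih => exact ih.switch

/-! ### The history of a box during a slide -/

/-- `T` is an increasing tableau of shape `ν/lam`, and removing the set `X` of inner corners from
`lam` leaves `lam'`. -/
structure IsSlide (ν lam lam' : YoungDiagram) (X : Finset (ℕ × ℕ)) (T : Filling) : Prop where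
  inc : T ∈ INC ν lam
  le : lam ≤ ν
  rem : IsRemoval lam lam' X

/-- Only step v creates or removes the label v; its positions are constant before and after that
step. -/
theorem run_label_iff_of_le {X : Finset (ℕ × ℕ)} {T : Filling} {k m v : ℕ} (hk : v ≤ k)
    (hm : v ≤ m) {x : ℕ × ℕ} : run X T k x = Box.label v ↔ run X T m x = Box.label v := by
  have key : ∀ n, v ≤ n → (run X T n x = Box.label v ↔ run X T v x = Box.label v) := by
    intro n hn
    induction n, hn using Nat.le_induction with
    | base => rfl
    | succ n hn ih => rw [run_succ, switch_eq_label_of_ne (by omega), ih]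
  rw [key k hk, key m hm]

theorem run_label_iff_of_lt {X : Finset (ℕ × ℕ)} {T : Filling} {k v : ℕ} (hk : k < v)
    {x : ℕ × ℕ} : run X T k x = Box.label v ↔ x ∉ X ∧ T x = Box.label v := by
  induction k with
  | zero =>
    by_cases hx : x ∈ X
    · simp [run_zero_of_mem hx, hx]
    · simp [run_zero_of_notMem hx, hx]
  | succ k ih => rw [run_succ, switch_eq_label_of_ne (by omega), ih (by omega)]

/-- The box `x` contains a bullet at some time. -/
def Visited (X : Finset (ℕ × ℕ)) (T : Filling) (x : ℕ × ℕ) : Prop :=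
  ∃ k, run X T k x = Box.bullet

theorem run_of_not_visited {X : Finset (ℕ × ℕ)} {T : Filling} {x : ℕ × ℕ}
    (h : ¬ Visited X T x) (k : ℕ) : run X T k x = T x := by
  have hb : ∀ k, run X T k x ≠ Box.bullet := fun k hk => h ⟨k, hk⟩
  induction k with
  | zero =>
    exact run_zero_of_notMem fun hx => hb 0 (run_zero_of_mem hx)
  | succ k ih =>
    have h1 := hb (k + 1)
    rw [run_succ] at h1 ⊢
    by_cases h2 : run X T k x = Box.label (k + 1)
    · rw [← ih, h2]
      have := switch_bullet_or.2 (Or.inr h2 : run X T k x = Box.bullet ∨ _)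
      tauto
    · rw [switch_of_ne (hb k) h2, ih]

theorem visited_of_mem {X : Finset (ℕ × ℕ)} {T : Filling} {x : ℕ × ℕ} (h : x ∈ X) :
    Visited X T x := ⟨0, run_zero_of_mem h⟩

namespace IsSlide

variable {ν lam lam' : YoungDiagram} {X : Finset (ℕ × ℕ)} {T : Filling}

theorem state (h : IsSlide ν lam lam' X T) (k : ℕ) : IsState ν lam' k (run X T k) :=
  isState_run h.inc h.le h.rem k

theorem notMem_of_label (h : IsSlide ν lam lam' X T) {x : ℕ × ℕ} {v : ℕ}
    (hx : T x = Box.label v) : x ∉ X := fun hX =>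
  ((INC.label_iff h.inc).1 ⟨v, hx⟩).2 (h.rem.corner x hX).1

theorem mem_of_bullet (h : IsSlide ν lam lam' X T) {x : ℕ × ℕ} {k : ℕ}
    (hx : run X T k x = Box.bullet) : x ∈ ν ∧ x ∉ lam' :=
  ((h.state k).supp x).1 (by simp [hx])

/-- A bullet sits in `X`, or in a box whose label has been processed. -/
theorem label_of_bullet (h : IsSlide ν lam lam' X T) {x : ℕ × ℕ} {k : ℕ}
    (hx : run X T k x = Box.bullet) (hX : x ∉ X) : ∃ t, t ≤ k ∧ T x = Box.label t := by
  have h1 := h.mem_of_bullet hx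
  obtain ⟨t, ht⟩ := (INC.label_iff h.inc).2 ⟨h1.1, fun h2 => h1.2 (h.rem.mem_iff.2 ⟨h2, hX⟩)⟩
  refine ⟨t, ?_, ht⟩
  by_contra hk
  rw [(run_label_iff_of_lt (by omega)).2 ⟨hX, ht⟩] at hx
  cases hx

/-- A box holds its bullet from the moment when its label is processed until it is filled. -/
theorem bullet_of_le (h : IsSlide ν lam lam' X T) {x : ℕ × ℕ} {j k : ℕ}
    (hx : run X T k x = Box.bullet) (hjk : j ≤ k)
    (hj : ∀ t, T x = Box.label t → t ≤ j) : run X T j x = Box.bullet := by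
  -- A label v ≤ j would survive until time k. A label v > j would be the original one, not yet
  -- processed.
  match hs : run X T j x with
  | Box.bullet => rfl
  | Box.empty =>
    exact absurd hs (((h.state j).supp x).2 (h.mem_of_bullet hx))
  | Box.label v =>
    by_cases hv : v ≤ j
    · rw [(run_label_iff_of_le hv (hv.trans hjk)).1 hs] at hx
      cases hx
    · have := hj v ((run_label_iff_of_lt (by omega)).1 hs).2
      omega

/-- A bullet next to the label being processed is filled with it. -/
theorem run_succ_bullet (h : IsSlide ν lam lam' X T) {x y : ℕ × ℕ} {k : ℕ}
    (hx : run X T k x = Box.bullet) (hxy : NextBox x y)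
    (hy : run X T k y = Box.label (k + 1)) : run X T (k + 1) x = Box.label (k + 1) := by
  rcases (h.state k).switch_bullet hx with h1 | h1
  · exact h1.1
  · exact absurd hy (h1.2 y hxy)

theorem run_succ_label (h : IsSlide ν lam lam' X T) {x y : ℕ × ℕ} {k : ℕ}
    (hx : run X T k x = Box.bullet) (hxy : NextBox x y)
    (hy : run X T k y = Box.label (k + 1)) : run X T (k + 1) y = Box.bullet := by
  rcases (h.state k).switch_label hy with h1 | h1
  · exact h1.1
  · exact absurd hx (h1.2 x hxy)

/-- Every visited box outside `X` is entered from a visited box above or to the left, which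
receives its label. -/
theorem exists_prev (h : IsSlide ν lam lam' X T) {p : ℕ × ℕ} (hp : Visited X T p)
    (hX : p ∉ X) : ∃ q, NextBox q p ∧ Visited X T q ∧
      ∃ w, T p = Box.label w ∧ ∀ N, w ≤ N → run X T N q = Box.label w := by
  obtain ⟨k, hk⟩ := hp
  obtain ⟨t, htk, ht⟩ := h.label_of_bullet hk hX
  have hpos := INC.pos h.inc ht
  obtain ⟨u, rfl⟩ : ∃ u, t = u + 1 := ⟨t - 1, by omega⟩
  have h1 : run X T (u + 1) p = Box.bullet :=
    h.bullet_of_le hk htk (by intro t h2; rw [ht] at h2; cases h2; rfl)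
  have h2 : run X T u p = Box.label (u + 1) := (run_label_iff_of_lt (by omega)).2 ⟨hX, ht⟩
  rcases (h.state u).switch_label h2 with ⟨-, q, hq, hq'⟩ | h3
  · refine ⟨q, hq, ⟨u, hq'⟩, u + 1, ht, fun N hN => ?_⟩
    exact (run_label_iff_of_le le_rfl hN).1 (h.run_succ_bullet hq' hq h2)
  · rw [run_succ, h3.1] at h1
    cases h1

/-- A visited box that does not keep its bullet passes it on. -/
theorem exists_next (h : IsSlide ν lam lam' X T) {p : ℕ × ℕ} {N : ℕ} (hp : Visited X T p)
    (hN : run X T N p ≠ Box.bullet) (hb : ∀ x v, T x = Box.label v → v ≤ N) :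
    ∃ q, NextBox p q ∧ Visited X T q := by
  obtain ⟨k, hk⟩ := hp
  have hkN : k ≤ N := by
    by_contra hlt
    exact hN (h.bullet_of_le hk (by omega) fun t ht => hb _ _ ht)
  clear hb
  induction N, hkN using Nat.le_induction with
  | base => exact absurd hk hN
  | succ m hm ih =>
    by_cases h2 : run X T m p = Box.bullet
    · rcases (h.state m).switch_bullet h2 with ⟨-, q, hq, hq'⟩ | h3
      · exact ⟨q, hq, m + 1, h.run_succ_label h2 hq hq'⟩
      · exact absurd h3.1 hN
    · exact ih h2

theorem mem_of_visited (h : IsSlide ν lam lam' X T) {x : ℕ × ℕ} (hx : Visited X T x) :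
    x ∈ ν ∧ x ∉ lam' := by
  obtain ⟨k, hk⟩ := hx
  exact h.mem_of_bullet hk

theorem run_ne_empty_iff (h : IsSlide ν lam lam' X T) {k : ℕ} {x : ℕ × ℕ} :
    run X T k x ≠ Box.empty ↔ x ∈ ν ∧ x ∉ lam' := (h.state k).supp x

/-- The labels that occur do not change. -/
theorem exists_label_iff (h : IsSlide ν lam lam' X T) (k v : ℕ) :
    (∃ x, run X T k x = Box.label v) ↔ ∃ x, T x = Box.label v := by
  induction k with
  | zero =>
    constructor
    · rintro ⟨x, hx⟩
      by_cases hX : x ∈ X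
      · simp [run_zero_of_mem hX] at hx
      · exact ⟨x, by rwa [run_zero_of_notMem hX] at hx⟩
    · rintro ⟨x, hx⟩
      exact ⟨x, by rwa [run_zero_of_notMem (h.notMem_of_label hx)]⟩
  | succ k ih =>
    rw [← ih]
    by_cases hv : k + 1 = v
    · subst hv
      constructor
      · rintro ⟨x, hx⟩
        rcases switch_bullet_or.1 (Or.inr hx) with h1 | h1
        · rcases (h.state k).switch_bullet h1 with ⟨-, d, -, hd⟩ | ⟨h2, -⟩
          · exact ⟨d, hd⟩
          · rw [run_succ, h2] at hx; cases hx
        · exact ⟨x, h1⟩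
      · rintro ⟨x, hx⟩
        rcases (h.state k).switch_label hx with ⟨-, d, hd, hd'⟩ | ⟨h2, -⟩
        · exact ⟨d, h.run_succ_bullet hd' hd hx⟩
        · exact ⟨x, h2⟩
    · simp only [run_succ, switch_eq_label_of_ne hv]

theorem run_label_le (h : IsSlide ν lam lam' X T) {N : ℕ}
    (hb : ∀ x v, T x = Box.label v → v ≤ N) {k v : ℕ} {x : ℕ × ℕ}
    (hx : run X T k x = Box.label v) : v ≤ N := by
  obtain ⟨y, hy⟩ := (h.exists_label_iff k v).1 ⟨x, hx⟩
  exact hb y v hy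

/-- Processing labels that do not occur has no effect. -/
theorem run_eq_of_le (h : IsSlide ν lam lam' X T) {N M : ℕ}
    (hb : ∀ x v, T x = Box.label v → v ≤ N) (hM : N ≤ M) : run X T M = run X T N := by
  induction M, hM using Nat.le_induction with
  | base => rfl
  | succ M hM ih =>
    rw [← ih, run_succ]
    funext c
    have hno : ∀ d, run X T M d ≠ Box.label (M + 1) := fun d hd => by
      have := h.run_label_le hb hd
      omega
    by_cases hc : run X T M c = Box.bullet
    · rcases (h.state M).switch_bullet hc with ⟨-, d, -, hd⟩ | ⟨h2, -⟩
      · exact absurd hd (hno d)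
      · rw [h2, hc]
    · exact switch_of_ne hc (hno c)

/-- Any bound on the labels may replace `maxLabel`, so that different tableaux can be run for the
same number of steps. -/
theorem Kjdt_eq (h : IsSlide ν lam lam' X T) {N : ℕ}
    (hb : ∀ x v, T x = Box.label v → v ≤ N) : Kjdt X T = eraseBullets (run X T N) := by
  have h1 : ∀ x v, T x = Box.label v → v ≤ maxLabel T := fun x v hx => INC.le_maxLabel h.inc hx
  have : run X T (maxLabel T) = run X T N := by
    rw [← h.run_eq_of_le h1 (le_max_left _ N), ← h.run_eq_of_le hb (le_max_right (maxLabel T) _)]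
  rw [Kjdt, ← this, run]

end IsSlide

/-! ### The tableau produced by a slide -/

theorem eraseBullets_eq_label {s : Filling} {x : ℕ × ℕ} {v : ℕ} :
    eraseBullets s x = Box.label v ↔ s x = Box.label v := by
  unfold eraseBullets
  match s x with
  | Box.empty => simp
  | Box.bullet => simp
  | Box.label n => simp

theorem eraseBullets_eq_empty {s : Filling} {x : ℕ × ℕ} :
    eraseBullets s x = Box.empty ↔ s x = Box.empty ∨ s x = Box.bullet := by
  unfold eraseBullets
  match s x with
  | Box.empty => simp
  | Box.bullet => simp
  | Box.label n => simp

theorem eraseBullets_congr {s s' : Filling} {x : ℕ × ℕ} (h : s x = s' x) :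
    eraseBullets s x = eraseBullets s' x := by
  simp only [eraseBullets, h]

theorem eraseBullets_of_ne {s : Filling} {x : ℕ × ℕ} (h : s x ≠ Box.bullet) :
    eraseBullets s x = s x := by
  unfold eraseBullets
  match hs : s x with
  | Box.empty => rfl
  | Box.bullet => exact absurd hs h
  | Box.label n => rfl

namespace IsSlide

variable {ν lam lam' : YoungDiagram} {X : Finset (ℕ × ℕ)} {T : Filling}

theorem exists_bound (h : IsSlide ν lam lam' X T) :
    ∃ N, ∀ x v, T x = Box.label v → v ≤ N := ⟨maxLabel T, fun _ _ hx => INC.le_maxLabel h.inc hx⟩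

theorem Kjdt_label_iff (h : IsSlide ν lam lam' X T) {N : ℕ}
    (hb : ∀ x v, T x = Box.label v → v ≤ N) {x : ℕ × ℕ} {v : ℕ} :
    Kjdt X T x = Box.label v ↔ run X T N x = Box.label v := by
  rw [h.Kjdt_eq hb, eraseBullets_eq_label]

theorem exists_Kjdt_label_iff (h : IsSlide ν lam lam' X T) {v : ℕ} :
    (∃ x, Kjdt X T x = Box.label v) ↔ ∃ x, T x = Box.label v := by
  obtain ⟨N, hN⟩ := h.exists_bound
  simp only [h.Kjdt_label_iff hN, h.exists_label_iff N v]

theorem Kjdt_of_not_visited (h : IsSlide ν lam lam' X T) {x : ℕ × ℕ} (hx : ¬ Visited X T x) :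
    Kjdt X T x = T x := by
  obtain ⟨N, hN⟩ := h.exists_bound
  have := run_of_not_visited hx N
  rw [h.Kjdt_eq hN, eraseBullets_of_ne (by rw [this]; exact INC.ne_bullet h.inc x), this]

/-- The boxes that hold a bullet at the end are corners of the outer shape. -/
theorem isInnerCorner_of_final (h : IsSlide ν lam lam' X T) {N : ℕ}
    (hb : ∀ x v, T x = Box.label v → v ≤ N) {x : ℕ × ℕ} (hx : run X T N x = Box.bullet) :
    IsInnerCorner ν x := by
  have h1 := h.mem_of_bullet hx
  have key : ∀ y, NextBox x y → y ∉ ν := by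
    intro y hxy hy
    have hy' : y ∉ lam' := fun h2 => h1.2 (hxy.mem h2)
    have hne := ((h.state N).supp y).2 ⟨hy, hy'⟩
    -- After step N a bullet outranks every label, so nothing can follow it.
    have hlt := (h.state N).lt x y hxy (by simp [hx]) hne
    match hs : run X T N y with
    | Box.empty => exact hne hs
    | Box.bullet => simp [hx, hs, Box.rank] at hlt
    | Box.label v =>
      have := h.run_label_le hb hs
      simp [hx, hs, Box.rank] at hlt
      omega
  exact ⟨h1.1, key _ (Or.inl rfl), key _ (Or.inr rfl)⟩

/-- A slide produces an increasing tableau; the outer shape loses the final bullets. -/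
theorem Kjdt_mem_INC (h : IsSlide ν lam lam' X T) {N : ℕ}
    (hb : ∀ x v, T x = Box.label v → v ≤ N) {ν' : YoungDiagram}
    (hν : ∀ x, x ∈ ν' ↔ x ∈ ν ∧ run X T N x ≠ Box.bullet) :
    Kjdt X T ∈ INC ν' lam' ∧ lam' ≤ ν' := by
  have hs := h.state N
  refine ⟨?_, ?_⟩
  · rw [h.Kjdt_eq hb]
    apply mem_INC_of_next
    · intro c hc hc'
      have h1 := (hν c).1 hc
      have h2 := (hs.supp c).2 ⟨h1.1, hc'⟩
      match h3 : run X T N c with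
      | Box.empty => exact absurd h3 h2
      | Box.bullet => exact absurd h3 h1.2
      | Box.label v => exact ⟨v, hs.pos c v h3, eraseBullets_eq_label.2 h3⟩
    · intro c hc
      rw [eraseBullets_eq_empty]
      by_contra h1
      push Not at h1
      exact hc ⟨(hν c).2 ⟨((hs.supp c).1 h1.1).1, h1.2⟩, ((hs.supp c).1 h1.1).2⟩
    · intro c d m n hcd hc hd
      rw [eraseBullets_eq_label] at hc hd
      have := hs.lt c d hcd (by simp [hc]) (by simp [hd])
      simp only [hc, hd, Box.rank] at this
      omega
  · intro c hc
    refine (hν c).2 ⟨h.le (h.rem.le hc), fun h1 => (h.mem_of_bullet h1).2 hc⟩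

theorem exists_Kjdt_mem_INC (h : IsSlide ν lam lam' X T) :
    ∃ ν', Kjdt X T ∈ INC ν' lam' ∧ lam' ≤ ν' := by
  classical
  obtain ⟨N, hN⟩ := h.exists_bound
  obtain ⟨ν', hν'⟩ := exists_isRemoval (lam := ν)
    (X := ν.cells.filter fun x => run X T N x = Box.bullet)
    (fun c hc => h.isInnerCorner_of_final hN (Finset.mem_filter.1 hc).2)
  refine ⟨ν', h.Kjdt_mem_INC hN fun x => ?_⟩
  rw [hν'.mem_iff, Finset.mem_filter, YoungDiagram.mem_cells]
  tauto

/-- From every visited box a chain of neighbours leads to a box that keeps its bullet. -/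
theorem exists_final (h : IsSlide ν lam lam' X T) {N : ℕ}
    (hb : ∀ x v, T x = Box.label v → v ≤ N) {S : Set (ℕ × ℕ)} {p : ℕ × ℕ}
    (hp : Visited X T p) (hpS : p ∈ S)
    (hS : ∀ x y, x ∈ S → NextBox x y → Visited X T y → y ∈ S) :
    ∃ e ∈ S, run X T N e = Box.bullet := by
  by_contra hcon
  push Not at hcon
  -- If no bullet came to rest in S, the chain of visited boxes would reach arbitrarily far
  -- antidiagonals.
  have key : ∀ n, ∃ q ∈ S, Visited X T q ∧ n ≤ q.1 + q.2 := by
    intro n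
    induction n with
    | zero => exact ⟨p, hpS, hp, Nat.zero_le _⟩
    | succ n ih =>
      obtain ⟨q, hq, hqv, hn⟩ := ih
      obtain ⟨r, hr, hrv⟩ := h.exists_next hqv (hcon q hq) hb
      refine ⟨r, hS q r hq hr hrv, hrv, ?_⟩
      rcases hr with rfl | rfl <;> simp <;> omega
  obtain ⟨n, hn⟩ := (ν.cells.finite_toSet.image fun c => c.1 + c.2).bddAbove
  obtain ⟨q, -, hq, hle⟩ := key (n + 1)
  have := hn ⟨q, (h.mem_of_visited hq).1, rfl⟩
  simp at this
  omega

/-- A final label v is in place from time v on, whereas the box keeps its original label u until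
step u. -/
theorem Kjdt_label_mono (h : IsSlide ν lam lam' X T) {x : ℕ × ℕ} {u v : ℕ}
    (hu : T x = Box.label u) (hv : Kjdt X T x = Box.label v) : u ≤ v := by
  obtain ⟨N, hN⟩ := h.exists_bound
  rw [h.Kjdt_label_iff hN] at hv
  by_contra hlt
  have h1 := (run_label_iff_of_le (h.run_label_le hN hv) le_rfl).1 hv
  have h2 : run X T v x = Box.label u :=
    (run_label_iff_of_lt (by omega)).2 ⟨h.notMem_of_label hu, hu⟩
  rw [h1] at h2
  cases h2
  exact hlt le_rfl

end IsSlide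

/-! ### Regions that bullets do not leave -/

/-- A bullet inside `A` is never drawn out of `A`: if a neighbour outside `A` is labelled, then the
other neighbour belongs to `A` and has a smaller label. -/
def Guarded (T : Filling) (A : Set (ℕ × ℕ)) : Prop :=
  ∀ a ∈ A, ∀ y, NextBox a y → y ∉ A → ∀ v, T y = Box.label v →
    ∃ z ∈ A, NextBox a z ∧ ∃ u < v, T z = Box.label u

theorem guarded_empty (T : Filling) : Guarded T ∅ := fun _ h => h.elim

/-- By `hi` and `hi'` no component of boxes with • or k + 1 crosses the boundary of A, so each step
on A depends only on the contents of A. -/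
theorem run_congr_on {X X' : Finset (ℕ × ℕ)} {T T' : Filling} {A : Set (ℕ × ℕ)}
    (h0 : ∀ x ∈ A, run X T 0 x = run X' T' 0 x)
    (hi : ∀ k, ∀ a ∈ A, ∀ y ∉ A, AdjBoxes a y →
      (run X T k a = Box.bullet ∨ run X T k a = Box.label (k + 1)) →
      ¬ (run X T k y = Box.bullet ∨ run X T k y = Box.label (k + 1)))
    (hi' : ∀ k, ∀ a ∈ A, ∀ y ∉ A, AdjBoxes a y →
      (run X' T' k a = Box.bullet ∨ run X' T' k a = Box.label (k + 1)) →
      ¬ (run X' T' k y = Box.bullet ∨ run X' T' k y = Box.label (k + 1)))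
    (k : ℕ) : ∀ x ∈ A, run X T k x = run X' T' k x := by
  induction k with
  | zero => exact h0
  | succ k ih =>
    intro x hx
    have key : ((run X T k x = Box.bullet ∨ run X T k x = Box.label (k + 1)) ∧
        ∃ d, AdjBoxes x d ∧ (run X T k d = Box.bullet ∨ run X T k d = Box.label (k + 1))) ↔
        ((run X' T' k x = Box.bullet ∨ run X' T' k x = Box.label (k + 1)) ∧
        ∃ d, AdjBoxes x d ∧ (run X' T' k d = Box.bullet ∨ run X' T' k d = Box.label (k + 1))) := by
      constructor
      · rintro ⟨h1, d, hd, h2⟩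
        have hdA : d ∈ A := by
          by_contra hdA
          exact hi k x hx d hdA hd h1 h2
        rw [ih x hx] at h1
        rw [ih d hdA] at h2
        exact ⟨h1, d, hd, h2⟩
      · rintro ⟨h1, d, hd, h2⟩
        have hdA : d ∈ A := by
          by_contra hdA
          exact hi' k x hx d hdA hd h1 h2
        rw [← ih x hx] at h1
        rw [← ih d hdA] at h2
        exact ⟨h1, d, hd, h2⟩
    rw [run_succ, run_succ, switch, switch]
    by_cases hc : ((run X T k x = Box.bullet ∨ run X T k x = Box.label (k + 1)) ∧
        ∃ d, AdjBoxes x d ∧ (run X T k d = Box.bullet ∨ run X T k d = Box.label (k + 1)))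
    · rw [if_pos hc, if_pos (key.1 hc), ih x hx]
    · rw [if_neg hc, if_neg (fun h => hc (key.2 h)), ih x hx]

namespace IsSlide

variable {ν lam lam' : YoungDiagram} {X : Finset (ℕ × ℕ)} {T : Filling} {A B : Set (ℕ × ℕ)}

/-- If the bullet were to leave A at label k + 1, the guard z would carry some u ≤ k. The bullet was
already in place when u was processed, because the original label of its box, if any, is smaller
than u; so u would have filled it. -/
theorem next_mem_of_guarded (h : IsSlide ν lam lam' X T) (hA : Guarded T A) {a y : ℕ × ℕ}
    {k : ℕ} (ha : a ∈ A) (hak : run X T k a = Box.bullet) (hay : NextBox a y)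
    (hy : run X T k y = Box.label (k + 1)) : y ∈ A := by
  by_contra hyA
  obtain ⟨z, hz, haz, u, huv, hzu⟩ :=
    hA a ha y hay hyA (k + 1) ((run_label_iff_of_lt (by omega)).1 hy).2
  have hpos := INC.pos h.inc hzu
  obtain ⟨w, rfl⟩ : ∃ w, u = w + 1 := ⟨u - 1, by omega⟩
  have h1 : run X T w a = Box.bullet := h.bullet_of_le hak (by omega) fun t ht => by
    have := INC.lt h.inc haz ht hzu
    omega
  have h2 : run X T w z = Box.label (w + 1) :=
    (run_label_iff_of_lt (by omega)).2 ⟨h.notMem_of_label hzu, hzu⟩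
  have h3 := h.run_succ_bullet h1 haz h2
  rw [run_label_iff_of_le (m := k) le_rfl (by omega), hak] at h3
  cases h3

theorem bullet_mem_of_guarded (h : IsSlide ν lam lam' X T) (hA : Guarded T A) (hB : Guarded T B)
    (hX : ∀ x ∈ X, x ∈ A ∨ x ∈ B) {x : ℕ × ℕ} {k : ℕ} (hx : run X T k x = Box.bullet) :
    x ∈ A ∨ x ∈ B := by
  induction k generalizing x with
  | zero =>
    by_cases hxX : x ∈ X
    · exact hX x hxX
    · rw [run_zero_of_notMem hxX] at hx
      exact absurd hx (INC.ne_bullet h.inc x)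
  | succ k ih =>
    rcases switch_bullet_or.1 (Or.inl hx) with h1 | h1
    · exact ih h1
    · rcases (h.state k).switch_label h1 with ⟨-, d, hd, hd'⟩ | ⟨h2, -⟩
      · rcases ih hd' with h3 | h3
        · exact Or.inl (h.next_mem_of_guarded hA h3 hd' hd h1)
        · exact Or.inr (h.next_mem_of_guarded hB h3 hd' hd h1)
      · rw [run_succ, h2] at hx; cases hx

theorem isolated_of_guarded (h : IsSlide ν lam lam' X T) (hA : Guarded T A) (hB : Guarded T B)
    (hAB : Disjoint A B) (hX : ∀ x ∈ X, x ∈ A ∨ x ∈ B) (k : ℕ) : ∀ a ∈ A, ∀ y ∉ A,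
    AdjBoxes a y → (run X T k a = Box.bullet ∨ run X T k a = Box.label (k + 1)) →
      ¬ (run X T k y = Box.bullet ∨ run X T k y = Box.label (k + 1)) := by
  intro a ha y hy hay h1 h2
  rcases h1 with h1 | h1
  · obtain ⟨h3, h4⟩ := (h.state k).bullet_next hay h1 h2
    exact hy (h.next_mem_of_guarded hA ha h1 h3 h4)
  · obtain ⟨h3, h4⟩ := (h.state k).label_prev hay h1 h2
    have h5 := (h.bullet_mem_of_guarded hA hB hX h4).resolve_left hy
    exact Set.disjoint_left.1 hAB ha (h.next_mem_of_guarded hB h5 h4 h3 h1)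

/-- Slides into corners of two disjoint guarded regions do not interact. -/
theorem Kjdt_union {νA lamA : YoungDiagram} {XA XB : Finset (ℕ × ℕ)}
    (h : IsSlide ν lam lam' (XA ∪ XB) T) (h1 : IsSlide ν lam lamA XA T)
    (h2 : IsSlide νA lamA lam' XB (Kjdt XA T)) (hA : Guarded T A) (hB : Guarded T B)
    (hAB : Disjoint A B) (hXA : ∀ x ∈ XA, x ∈ A) (hXB : ∀ x ∈ XB, x ∈ B)
    (hB' : ∀ x ∈ B, (∃ v, T x = Box.label v) ∨ x ∈ XB) :
    Kjdt (XA ∪ XB) T = Kjdt XB (Kjdt XA T) := by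
  obtain ⟨N, hN⟩ := h.exists_bound
  have hN2 : ∀ x v, Kjdt XA T x = Box.label v → v ≤ N := by
    intro x v hx
    obtain ⟨y, hy⟩ := h1.exists_Kjdt_label_iff.1 ⟨x, hx⟩
    exact hN y v hy
  have hXAB : ∀ x ∈ XA ∪ XB, x ∈ A ∨ x ∈ B := fun x hx =>
    (Finset.mem_union.1 hx).imp (hXA x) (hXB x)
  have hunv1 : ∀ x, x ∉ A → ¬ Visited XA T x := by
    rintro x hx ⟨k, hk⟩
    exact hx (by simpa using h1.bullet_mem_of_guarded hA hA (fun x hx => Or.inl (hXA x hx)) hk)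
  -- B stays guarded: the slide into XA does not change the guards inside B and can only increase
  -- the labels outside.
  have hKB : Guarded (Kjdt XA T) B := by
    intro b hb y hby hyB v hv
    have hyA : ∃ v', T y = Box.label v' := by
      have h3 := h1.run_ne_empty_iff.1 (by
        rw [(h1.Kjdt_label_iff hN).1 hv]; simp : run XA T N y ≠ Box.empty)
      refine (INC.label_iff h.inc).2 ⟨h3.1, ?_⟩
      rcases hB' b hb with h4 | h4
      · exact fun h5 => ((INC.label_iff h.inc).1 h4).2 (hby.mem h5)
      · exact (h.rem.corner b (Finset.mem_union_right _ h4)).notMem hby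
    obtain ⟨v', hv'⟩ := hyA
    obtain ⟨z, hz, hbz, u, hu, hzu⟩ := hB b hb y hby hyB v' hv'
    refine ⟨z, hz, hbz, u, hu.trans_le (h1.Kjdt_label_mono hv' hv), ?_⟩
    rw [h1.Kjdt_of_not_visited (hunv1 z fun hzA => Set.disjoint_left.1 hAB hzA hz), hzu]
  funext x
  -- On A the joint slide runs like the slide into XA alone, on B like the second slide, and
  -- elsewhere nothing moves.
  by_cases hxA : x ∈ A
  · have hxB : x ∉ B := fun hxB => Set.disjoint_left.1 hAB hxA hxB
    have h3 : ¬ Visited XB (Kjdt XA T) x := by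
      rintro ⟨k, hk⟩
      exact hxB (by
        simpa using h2.bullet_mem_of_guarded hKB hKB (fun x hx => Or.inl (hXB x hx)) hk)
    rw [h2.Kjdt_of_not_visited h3, h.Kjdt_eq hN, h1.Kjdt_eq hN]
    refine eraseBullets_congr (run_congr_on ?_ (h.isolated_of_guarded hA hB hAB hXAB)
      (h1.isolated_of_guarded hA (guarded_empty T) (by simp) fun x hx => Or.inl (hXA x hx)) N x hxA)
    intro x hx
    have hx2 : x ∉ XB := fun hxB => Set.disjoint_left.1 hAB hx (hXB x hxB)
    by_cases hx1 : x ∈ XA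
    · rw [run_zero_of_mem hx1, run_zero_of_mem (Finset.mem_union_left _ hx1)]
    · rw [run_zero_of_notMem hx1, run_zero_of_notMem (by simp [hx1, hx2])]
  · by_cases hxB : x ∈ B
    · rw [h.Kjdt_eq hN, h2.Kjdt_eq hN2]
      refine eraseBullets_congr (run_congr_on ?_ (h.isolated_of_guarded hB hA hAB.symm
        fun x hx => (hXAB x hx).symm) (h2.isolated_of_guarded hKB (guarded_empty _) (by simp)
          fun x hx => Or.inl (hXB x hx)) N x hxB)
      intro x hx
      have hx2 : x ∉ A := fun hxA => Set.disjoint_left.1 hAB hxA hx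
      have hx3 : x ∉ XA := fun hxA => hx2 (hXA x hxA)
      by_cases hx1 : x ∈ XB
      · rw [run_zero_of_mem hx1, run_zero_of_mem (Finset.mem_union_right _ hx1)]
      · rw [run_zero_of_notMem hx1, run_zero_of_notMem (by simp [hx1, hx3]),
          h1.Kjdt_of_not_visited (hunv1 x hx2)]
    · have h3 : ¬ Visited XB (Kjdt XA T) x := by
        rintro ⟨k, hk⟩
        exact hxB (by
          simpa using h2.bullet_mem_of_guarded hKB hKB (fun x hx => Or.inl (hXB x hx)) hk)
      have h4 : ¬ Visited (XA ∪ XB) T x := by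
        rintro ⟨k, hk⟩
        exact (h.bullet_mem_of_guarded hA hB hXAB hk).elim hxA hxB
      rw [h2.Kjdt_of_not_visited h3, h1.Kjdt_of_not_visited (hunv1 x hxA),
        h.Kjdt_of_not_visited h4]

end IsSlide

/-! ### The track of a slide separates the plane -/

theorem IsInnerCorner.eq_of_le {ν : YoungDiagram} {e x : ℕ × ℕ} (he : IsInnerCorner ν e)
    (hx : x ∈ ν) (hex : e ≤ x) : e = x := by
  by_contra hne
  rcases lt_or_eq_of_le hex.1 with h1 | h1
  · exact he.2.1 (ν.isLowerSet (show (e.1 + 1, e.2) ≤ x from ⟨h1, hex.2⟩) hx)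
  · rcases lt_or_eq_of_le hex.2 with h2 | h2
    · exact he.2.2 (ν.isLowerSet (show (e.1, e.2 + 1) ≤ x from ⟨hex.1, h2⟩) hx)
    · exact hne (Prod.ext h1 h2)

/-- The boxes that are weakly to the right of all visited boxes in the rows above them. -/
def rightRegion (X : Finset (ℕ × ℕ)) (T : Filling) : Set (ℕ × ℕ) :=
  {x | ∀ p, Visited X T p → p.1 ≤ x.1 → p.2 ≤ x.2}

/-- The boxes that are weakly below all visited boxes in the columns to their left. -/
def leftRegion (X : Finset (ℕ × ℕ)) (T : Filling) : Set (ℕ × ℕ) :=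
  {x | ∀ p, Visited X T p → p.2 ≤ x.2 → p.1 ≤ x.1}

/-- The part of a region on which later slides take place. -/
def activePart (T : Filling) (Y : Finset (ℕ × ℕ)) (S : Set (ℕ × ℕ)) : Set (ℕ × ℕ) :=
  {x | x ∈ S ∧ ((∃ v, T x = Box.label v) ∨ x ∈ Y)}

namespace IsSlide

variable {ν lam lam' : YoungDiagram} {d : ℕ × ℕ} {T : Filling} {Y : Finset (ℕ × ℕ)}

theorem notMem_of_Kjdt_label {X : Finset (ℕ × ℕ)} (h : IsSlide ν lam lam' X T) {x : ℕ × ℕ}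
    {v : ℕ} (hx : Kjdt X T x = Box.label v) : x ∈ ν ∧ x ∉ lam' := by
  obtain ⟨N, hN⟩ := h.exists_bound
  exact h.run_ne_empty_iff.1 (by
    rw [(h.Kjdt_label_iff hN).1 hx]; simp : run X T N x ≠ Box.empty)

theorem mem_of_ne (h : IsSlide ν lam lam' {d} T) {x : ℕ × ℕ} (hx : x ≤ d) (hne : x ≠ d) :
    x ∈ lam' :=
  h.rem.mem_iff.2 ⟨lam.isLowerSet hx (h.rem.corner d (by simp)).1, by simpa using hne⟩

theorem le_of_visited (h : IsSlide ν lam lam' {d} T) {p : ℕ × ℕ} (hp : Visited {d} T p) :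
    d ≤ p := by
  induction hn : p.1 + p.2 using Nat.strong_induction_on generalizing p with
  | _ n ih =>
    by_cases hpd : p = d
    · exact hpd.ge
    · obtain ⟨q, hq, hqv, -⟩ := h.exists_prev hp (by simpa using hpd)
      refine (ih (q.1 + q.2) ?_ hqv rfl).trans hq.le
      rcases hq with rfl | rfl <;> simp at hn <;> omega

/-- Only a downward step can leave the region, and then the track runs along the row below, through
(i + 1, j) and (i + 1, j + 1). So the label v now below the bullet came from (i + 1, j + 1). The box
(i, j + 1) above that one is off the track and keeps its label, which is smaller than v: it is the
guard. -/
theorem guarded_right (h : IsSlide ν lam lam' {d} T) (hY : ∀ y ∈ Y, IsInnerCorner lam' y) :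
    Guarded (Kjdt {d} T) (activePart (Kjdt {d} T) Y (rightRegion {d} T)) := by
  rintro ⟨i, j⟩ ⟨ha, ha'⟩ y hay hy v hv
  have hyR : y ∉ rightRegion {d} T := fun hyR => hy ⟨hyR, Or.inl ⟨v, hv⟩⟩
  rcases hay with rfl | rfl
  swap
  · exact absurd (fun p hp h1 => (ha p hp h1).trans (Nat.le_succ _)) hyR
  dsimp only at hyR hv hy ⊢
  -- Trace the track backwards along row i + 1. It cannot have come from row i, whose visited boxes
  -- lie weakly left of column j; the box (i + 1, j + 1) was entered from (i + 1, j), which received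
  -- its label.
  have key : ∀ n i', i' ≤ i + 1 → Visited {d} T (i', j + 1 + n) →
      Visited {d} T (i + 1, j + 1) ∧ T (i + 1, j + 1) = Box.label v := by
    intro n
    induction n with
    | zero =>
      intro i' hi' hp
      obtain rfl : i' = i + 1 := by
        by_contra hne
        have := ha _ hp (by simp; omega)
        simp at this
      refine ⟨hp, ?_⟩
      have hpd : (i + 1, j + 1) ≠ d := by
        rintro rfl
        exact (h.notMem_of_Kjdt_label hv).2 (h.mem_of_ne (by simp) (by simp))
      obtain ⟨q, hq, hqv, w, hw, hwN⟩ := h.exists_prev hp (by simpa using hpd)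
      obtain ⟨q1, q2⟩ := q
      rcases hq with hq | hq <;> simp only [Prod.mk.injEq] at hq
      · have := ha _ hqv (by simp; omega)
        simp at this; omega
      · obtain ⟨rfl, rfl⟩ : i + 1 = q1 ∧ j = q2 := by omega
        obtain ⟨N, hN⟩ := h.exists_bound
        have h3 := hwN N (hN _ _ hw)
        rw [h.Kjdt_label_iff hN, h3] at hv
        rw [hw]; exact hv
    | succ n ih =>
      intro i' hi' hp
      obtain rfl : i' = i + 1 := by
        by_contra hne
        have := ha _ hp (by simp; omega)
        simp at this; omega
      have hpd : (i + 1, j + 1 + (n + 1)) ≠ d := by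
        rintro rfl
        exact (h.notMem_of_Kjdt_label hv).2
          (h.mem_of_ne ⟨le_rfl, by simp; omega⟩ (by simp; omega))
      obtain ⟨q, hq, hqv, -⟩ := h.exists_prev hp (by simpa using hpd)
      obtain ⟨q1, q2⟩ := q
      rcases hq with hq | hq <;> simp only [Prod.mk.injEq] at hq
      · have := ha _ hqv (by simp; omega)
        simp at this; omega
      · obtain ⟨rfl, rfl⟩ : i + 1 = q1 ∧ q2 = j + 1 + n := by omega
        exact ih _ le_rfl hqv
  obtain ⟨p, hp, hp1, hp2⟩ : ∃ p, Visited {d} T p ∧ p.1 ≤ i + 1 ∧ j < p.2 := by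
    by_contra hcon
    push Not at hcon
    exact hyR hcon
  obtain ⟨hvis, hlab⟩ := key (p.2 - (j + 1)) p.1 hp1 (by
    rwa [show j + 1 + (p.2 - (j + 1)) = p.2 by omega])
  have hznv : ¬ Visited {d} T (i, j + 1) := fun hz => by
    have := ha _ hz (by simp)
    simp at this
  have hzl : (i, j + 1) ∉ lam := by
    intro hz
    have hz' : (i, j + 1) ∈ lam' := h.rem.mem_iff.2 ⟨hz, fun hzd => hznv (visited_of_mem hzd)⟩
    rcases ha' with ⟨w, hw⟩ | ha'
    · exact (h.notMem_of_Kjdt_label hw).2 (NextBox.mem (Or.inr rfl) hz')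
    · exact (hY _ ha').2.2 hz'
  obtain ⟨u, hu⟩ := (INC.label_iff h.inc).2
    ⟨NextBox.mem (Or.inl rfl) (h.mem_of_visited hvis).1, hzl⟩
  have hu' : Kjdt {d} T (i, j + 1) = Box.label u := by rw [h.Kjdt_of_not_visited hznv, hu]
  exact ⟨(i, j + 1), ⟨fun p hp h1 => (ha p hp h1).trans (Nat.le_succ _), Or.inl ⟨u, hu'⟩⟩,
    Or.inr rfl, u, INC.lt h.inc (Or.inl rfl) hu hlab, hu'⟩

/-- The transpose of `guarded_right`. -/
theorem guarded_left (h : IsSlide ν lam lam' {d} T) (hY : ∀ y ∈ Y, IsInnerCorner lam' y) :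
    Guarded (Kjdt {d} T) (activePart (Kjdt {d} T) Y (leftRegion {d} T)) := by
  rintro ⟨i, j⟩ ⟨ha, ha'⟩ y hay hy v hv
  have hyR : y ∉ leftRegion {d} T := fun hyR => hy ⟨hyR, Or.inl ⟨v, hv⟩⟩
  rcases hay with rfl | rfl
  · exact absurd (fun p hp h1 => (ha p hp h1).trans (Nat.le_succ _)) hyR
  dsimp only at hyR hv hy ⊢
  have key : ∀ n j', j' ≤ j + 1 → Visited {d} T (i + 1 + n, j') →
      Visited {d} T (i + 1, j + 1) ∧ T (i + 1, j + 1) = Box.label v := by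
    intro n
    induction n with
    | zero =>
      intro j' hj' hp
      obtain rfl : j' = j + 1 := by
        by_contra hne
        have := ha _ hp (by simp; omega)
        simp at this
      refine ⟨hp, ?_⟩
      have hpd : (i + 1, j + 1) ≠ d := by
        rintro rfl
        exact (h.notMem_of_Kjdt_label hv).2 (h.mem_of_ne (by simp) (by simp))
      obtain ⟨q, hq, hqv, w, hw, hwN⟩ := h.exists_prev hp (by simpa using hpd)
      obtain ⟨q1, q2⟩ := q
      rcases hq with hq | hq <;> simp only [Prod.mk.injEq] at hq
      · obtain ⟨rfl, rfl⟩ : i = q1 ∧ j + 1 = q2 := by omega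
        obtain ⟨N, hN⟩ := h.exists_bound
        have h3 := hwN N (hN _ _ hw)
        rw [h.Kjdt_label_iff hN, h3] at hv
        rw [hw]; exact hv
      · have := ha _ hqv (by simp; omega)
        simp at this; omega
    | succ n ih =>
      intro j' hj' hp
      obtain rfl : j' = j + 1 := by
        by_contra hne
        have := ha _ hp (by simp; omega)
        simp at this; omega
      have hpd : (i + 1 + (n + 1), j + 1) ≠ d := by
        rintro rfl
        exact (h.notMem_of_Kjdt_label hv).2
          (h.mem_of_ne ⟨by simp; omega, le_rfl⟩ (by simp; omega))
      obtain ⟨q, hq, hqv, -⟩ := h.exists_prev hp (by simpa using hpd)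
      obtain ⟨q1, q2⟩ := q
      rcases hq with hq | hq <;> simp only [Prod.mk.injEq] at hq
      · obtain ⟨rfl, rfl⟩ : q1 = i + 1 + n ∧ j + 1 = q2 := by omega
        exact ih _ le_rfl hqv
      · have := ha _ hqv (by simp; omega)
        simp at this; omega
  obtain ⟨p, hp, hp1, hp2⟩ : ∃ p, Visited {d} T p ∧ p.2 ≤ j + 1 ∧ i < p.1 := by
    by_contra hcon
    push Not at hcon
    exact hyR hcon
  obtain ⟨hvis, hlab⟩ := key (p.1 - (i + 1)) p.2 hp1 (by
    rwa [show i + 1 + (p.1 - (i + 1)) = p.1 by omega])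
  have hznv : ¬ Visited {d} T (i + 1, j) := fun hz => by
    have := ha _ hz (by simp)
    simp at this
  have hzl : (i + 1, j) ∉ lam := by
    intro hz
    have hz' : (i + 1, j) ∈ lam' := h.rem.mem_iff.2 ⟨hz, fun hzd => hznv (visited_of_mem hzd)⟩
    rcases ha' with ⟨w, hw⟩ | ha'
    · exact (h.notMem_of_Kjdt_label hw).2 (NextBox.mem (Or.inl rfl) hz')
    · exact (hY _ ha').2.1 hz'
  obtain ⟨u, hu⟩ := (INC.label_iff h.inc).2
    ⟨NextBox.mem (Or.inr rfl) (h.mem_of_visited hvis).1, hzl⟩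
  have hu' : Kjdt {d} T (i + 1, j) = Box.label u := by rw [h.Kjdt_of_not_visited hznv, hu]
  exact ⟨(i + 1, j), ⟨fun p hp h1 => (ha p hp h1).trans (Nat.le_succ _), Or.inl ⟨u, hu'⟩⟩,
    Or.inl rfl, u, INC.lt h.inc (Or.inr rfl) hu hlab, hu'⟩

/-- A common box x below or level with d would confine the track to the boxes weakly northwest of x.
Its end, a corner of ν outside lam', would then be x itself, although no label remains there, or
would lie in lam'. -/
theorem disjoint_regions {Z : Finset (ℕ × ℕ)} (h : IsSlide ν lam lam' {d} T)
    (hY : ∀ y ∈ Y, IsInnerCorner lam' y) :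
    Disjoint (activePart (Kjdt {d} T) Y (rightRegion {d} T))
      (activePart (Kjdt {d} T) Z (leftRegion {d} T)) := by
  rw [Set.disjoint_left]
  rintro x ⟨hxr, hx⟩ ⟨hxl, -⟩
  have hd : Visited {d} T d := visited_of_mem (by simp)
  by_cases h1 : d.1 ≤ x.1
  · obtain ⟨N, hN⟩ := h.exists_bound
    obtain ⟨e, hex, he⟩ := h.exists_final hN (S := {p | p ≤ x}) hd ⟨h1, hxr d hd h1⟩ (by
      rintro y z hyx hyz hz
      rcases hyz with rfl | rfl
      · have := hxl _ hz hyx.2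
        exact ⟨this, hyx.2⟩
      · have := hxr _ hz hyx.1
        exact ⟨hyx.1, this⟩)
    rcases hx with ⟨v, hv⟩ | hx
    · have := (h.isInnerCorner_of_final hN he).eq_of_le (h.notMem_of_Kjdt_label hv).1 hex
      rw [h.Kjdt_label_iff hN, ← this, he] at hv
      cases hv
    · exact (h.mem_of_bullet he).2 (lam'.isLowerSet hex (hY x hx).1)
  -- Here x is strictly northwest of d, hence too deep inside lam' to be labelled or to be a corner.
  · have h2 : x.2 < d.2 := by
      by_contra h2
      exact h1 (hxl d hd (not_lt.1 h2))
    have h3 : (x.1 + 1, x.2) ∈ lam' := h.mem_of_ne ⟨by simp; omega, h2.le⟩ (by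
      intro h4; rw [← h4] at h2; simp at h2)
    rcases hx with ⟨v, hv⟩ | hx
    · exact (h.notMem_of_Kjdt_label hv).2 (NextBox.mem (Or.inl rfl) h3)
    · exact (hY x hx).2.1 h3

theorem mem_rightRegion (h : IsSlide ν lam lam' {d} T) {x : ℕ × ℕ} (hx : x.1 < d.1) :
    x ∈ rightRegion {d} T := fun _ hp h1 =>
  absurd ((h.le_of_visited hp).1.trans h1) (not_le.2 hx)

theorem mem_leftRegion (h : IsSlide ν lam lam' {d} T) {x : ℕ × ℕ} (hx : x.2 < d.2) :
    x ∈ leftRegion {d} T := fun _ hp h1 =>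
  absurd ((h.le_of_visited hp).2.trans h1) (not_le.2 hx)

end IsSlide

/-! ### Independence of the rectification order -/

/-- The box `c` can be added to the Young diagram `lam`. -/
def IsAddable (lam : YoungDiagram) (c : ℕ × ℕ) : Prop :=
  c ∉ lam ∧ ∀ x, NextBox x c → x ∈ lam

theorem IsAddable.mem_of_le {lam : YoungDiagram} {c x : ℕ × ℕ} (h : IsAddable lam c)
    (hx : x ≤ c) (hne : x ≠ c) : x ∈ lam := by
  rcases lt_or_eq_of_le hx.1 with h1 | h1
  · exact lam.isLowerSet (show x ≤ (c.1 - 1, c.2) from ⟨by simp; omega, hx.2⟩)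
      (h.2 _ (Or.inl (Prod.ext (by simp; omega) rfl)))
  · rcases lt_or_eq_of_le hx.2 with h2 | h2
    · exact lam.isLowerSet (show x ≤ (c.1, c.2 - 1) from ⟨hx.1, by simp; omega⟩)
        (h.2 _ (Or.inr (Prod.ext rfl (by simp; omega))))
    · exact absurd (Prod.ext h1 h2) hne

theorem IsAddable.row_ne {lam : YoungDiagram} {c d : ℕ × ℕ} (hc : IsAddable lam c)
    (hd : IsAddable lam d) (hne : c ≠ d) : c.1 ≠ d.1 := by
  intro h
  rcases le_total c.2 d.2 with h2 | h2
  · exact hc.1 (hd.mem_of_le ⟨h.le, h2⟩ hne)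
  · exact hd.1 (hc.mem_of_le ⟨h.ge, h2⟩ hne.symm)

theorem exists_isRemoval_of_addable {lam : YoungDiagram} {Y : Finset (ℕ × ℕ)}
    (hY : ∀ y ∈ Y, IsAddable lam y) :
    ∃ lam', (∀ c, c ∈ lam' ↔ c ∈ lam ∨ c ∈ Y) ∧ IsRemoval lam' lam Y := by
  let lam' : YoungDiagram := ⟨lam.cells ∪ Y, by
    intro c d hdc hc
    simp only [Finset.coe_union, Set.mem_union, Finset.mem_coe, YoungDiagram.mem_cells] at hc ⊢
    rcases hc with hc | hc
    · exact Or.inl (lam.isLowerSet hdc hc)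
    · by_cases h : d = c
      · exact Or.inr (h ▸ hc)
      · exact Or.inl ((hY c hc).mem_of_le hdc h)⟩
  have hmem : ∀ c, c ∈ lam' ↔ c ∈ lam ∨ c ∈ Y := fun c => by
    rw [← YoungDiagram.mem_cells]
    simp [lam']
  refine ⟨lam', hmem, ?_, ?_⟩
  · intro c hc
    have key : ∀ d, NextBox c d → d ∉ lam' := by
      intro d hcd hd
      rcases (hmem d).1 hd with h | h
      · exact (hY c hc).1 (hcd.mem h)
      · exact (hY c hc).1 ((hY d h).2 c hcd)
    exact ⟨(hmem c).2 (Or.inr hc), key _ (Or.inl rfl), key _ (Or.inr rfl)⟩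
  · ext c
    simp only [lam', Finset.mem_sdiff, Finset.mem_union, YoungDiagram.mem_cells]
    have : c ∈ Y → c ∉ lam := fun h => (hY c h).1
    tauto

namespace IsRemoval

variable {lam lam' : YoungDiagram} {X Y : Finset (ℕ × ℕ)}

theorem mem_iff' (h : IsRemoval lam lam' X) {c : ℕ × ℕ} : c ∈ lam ↔ c ∈ lam' ∨ c ∈ X := by
  have h1 := h.mem_iff (c := c)
  have h2 := fun hc => (h.corner c hc).1
  tauto

theorem addable (h : IsRemoval lam lam' X) {c : ℕ × ℕ} (hc : c ∈ X) : IsAddable lam' c :=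
  ⟨fun h1 => (h.mem_iff.1 h1).2 hc, fun _ hx => h.mem_iff.2
    ⟨hx.mem (h.corner c hc).1, fun hxX => (h.corner _ hxX).notMem hx (h.corner c hc).1⟩⟩

theorem eq {lam₂ : YoungDiagram} (h : IsRemoval lam lam' X) (h₂ : IsRemoval lam₂ lam' X) :
    lam = lam₂ :=
  SetLike.ext fun _ => by rw [h.mem_iff', h₂.mem_iff']

theorem of_union (h : IsRemoval lam lam' (X ∪ Y)) (hXY : Disjoint X Y) :
    ∃ lam₁, IsRemoval lam lam₁ X ∧ IsRemoval lam₁ lam' Y := by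
  obtain ⟨lam₁, h1⟩ := exists_isRemoval fun c hc => h.corner c (Finset.mem_union_left Y hc)
  refine ⟨lam₁, h1, fun c hc => ?_, ?_⟩
  · have h2 := h.corner c (Finset.mem_union_right X hc)
    exact ⟨h1.mem_iff.2 ⟨h2.1, fun h3 => Finset.disjoint_left.1 hXY h3 hc⟩,
      fun h3 => h2.2.1 (h1.le h3), fun h3 => h2.2.2 (h1.le h3)⟩
  · rw [h1.cells, h.cells, sdiff_sdiff_left]; rfl

theorem card_lt (h : IsRemoval lam lam' X) (hX : X.Nonempty) {R : YoungDiagram} (hR : lam ≤ R) :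
    (R.cells \ lam.cells).card < (R.cells \ lam'.cells).card := by
  apply Finset.card_lt_card
  rw [Finset.ssubset_iff_of_subset]
  · obtain ⟨x, hx⟩ := hX
    have := (h.corner x hx).1
    refine ⟨x, ?_, ?_⟩
    · simp only [Finset.mem_sdiff, YoungDiagram.mem_cells]
      exact ⟨hR this, (h.addable hx).1⟩
    · simp [this]
  · exact Finset.sdiff_subset_sdiff le_rfl h.le

end IsRemoval

theorem exists_add_box {lam R : YoungDiagram} (hle : lam ≤ R) (hne : lam ≠ R) :
    ∃ d lam', lam' ≤ R ∧ IsRemoval lam' lam {d} := by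
  have hne' : (R.cells \ lam.cells).Nonempty := by
    rw [Finset.sdiff_nonempty]
    exact fun h => hne (le_antisymm hle h)
  obtain ⟨d, hd, hmin⟩ := Finset.exists_min_image _ (fun c : ℕ × ℕ => c.1 + c.2) hne'
  simp only [Finset.mem_sdiff, YoungDiagram.mem_cells] at hd hmin
  have hadd : IsAddable lam d := ⟨hd.2, fun x hx => by
    by_contra hxl
    have := hmin x ⟨hx.mem hd.1, hxl⟩
    rcases hx with rfl | rfl <;> simp at this⟩
  obtain ⟨lam', h1, h2⟩ := exists_isRemoval_of_addable (Y := {d}) (by simpa using hadd)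
  refine ⟨d, lam', fun c hc => ?_, h2⟩
  rcases (h1 c).1 hc with h3 | h3
  · exact hle h3
  · rw [Finset.mem_singleton] at h3; exact h3 ▸ hd.1

/-- `Reach R T lam T'`: some sequence of slides, starting with the tableau `T` of inner shape `R`,
leads to the tableau `T'` of inner shape `lam`. -/
inductive Reach (R : YoungDiagram) (T : Filling) : YoungDiagram → Filling → Prop
  | refl : Reach R T R T
  | slide (lam lam' : YoungDiagram) (X : Finset (ℕ × ℕ)) (T' : Filling) (hne : X.Nonempty)
      (hX : IsRemoval lam lam' X) (h : Reach R T lam T') : Reach R T lam' (Kjdt X T')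

namespace Reach

variable {R ν lam : YoungDiagram} {T T' : Filling}

theorem le (h : Reach R T lam T') : lam ≤ R := by
  induction h with
  | refl => exact le_rfl
  | slide lam lam' X T' hne hX h ih => exact hX.le.trans ih

theorem exists_mem_INC (h : Reach R T lam T') (hT : T ∈ INC ν R) (hR : R ≤ ν) :
    ∃ ν', T' ∈ INC ν' lam ∧ lam ≤ ν' := by
  induction h with
  | refl => exact ⟨ν, hT, hR⟩
  | slide lam lam' X T' hne hX h ih =>
    obtain ⟨ν', h1, h2⟩ := ih
    exact (IsSlide.mk h1 h2 hX).exists_Kjdt_mem_INC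

theorem exists_isSlide (h : Reach R T lam T') (hT : T ∈ INC ν R) (hR : R ≤ ν)
    {lam' : YoungDiagram} {X : Finset (ℕ × ℕ)} (hX : IsRemoval lam lam' X) :
    ∃ ν', IsSlide ν' lam lam' X T' := by
  obtain ⟨ν', h1, h2⟩ := h.exists_mem_INC hT hR
  exact ⟨ν', h1, h2, hX⟩

/-- `KRectifiesTo` peels off the first slide and `Reach` the last one; the induction for uniqueness
needs the latter. -/
theorem of_KRectifiesTo {C : Filling} (h : KRectifiesTo lam T' C) (h' : Reach R T lam T') :
    Reach R T ⊥ C := by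
  induction h with
  | done T' => exact h'
  | slide lam lam' X T' C hne hX hlam' h ih => exact ih (.slide _ _ _ _ hne ⟨hX, hlam'⟩ h')

end Reach

theorem exists_reach {R : YoungDiagram} (T : Filling) {lam : YoungDiagram} (hle : lam ≤ R) :
    ∃ T', Reach R T lam T' := by
  induction hn : (R.cells \ lam.cells).card using Nat.strong_induction_on generalizing lam with
  | _ n ih =>
    by_cases hne : lam = R
    · exact hne ▸ ⟨T, .refl⟩
    · obtain ⟨d, lam', h1, h2⟩ := exists_add_box hle hne
      obtain ⟨T', hT'⟩ := ih _ (hn ▸ h2.card_lt (by simp) h1) h1 rfl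
      exact ⟨_, .slide _ _ _ _ (by simp) h2 hT'⟩

theorem exists_KRectifiesTo (lam : YoungDiagram) (T : Filling) : ∃ C, KRectifiesTo lam T C := by
  induction hn : lam.cells.card using Nat.strong_induction_on generalizing lam T with
  | _ n ih =>
    by_cases hne : lam = ⊥
    · exact hne ▸ ⟨T, .done T⟩
    · have hne' : lam.cells.Nonempty := by
        rw [Finset.nonempty_iff_ne_empty]
        intro h
        exact hne (YoungDiagram.ext h)
      obtain ⟨d, hd, hmax⟩ := Finset.exists_max_image _ (fun c : ℕ × ℕ => c.1 + c.2) hne'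
      have hc : IsInnerCorner lam d := by
        refine ⟨hd, fun h => ?_, fun h => ?_⟩
        · have := hmax _ h
          simp at this
        · have := hmax _ h
          simp at this
      obtain ⟨lam', h'⟩ := exists_isRemoval (X := {d}) (by simpa using hc)
      obtain ⟨C, hC⟩ := ih lam'.cells.card (by
        rw [← hn, h'.cells, Finset.sdiff_singleton_eq_erase]
        exact Finset.card_erase_lt_of_mem hd) lam' (Kjdt {d} T) rfl
      exact ⟨C, .slide _ _ _ _ _ (by simp) h'.corner h'.cells hC⟩

theorem mem_rectangle {a b : ℕ} {c : ℕ × ℕ} : c ∈ rectangle a b ↔ c.1 < a ∧ c.2 < b := by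
  rw [← YoungDiagram.mem_cells]
  simp [rectangle]

section Independence

variable {a b : ℕ} {ν lam lam₁ : YoungDiagram} {T : Filling}

/-- Between two corners of `lam₁` inside the rectangle there is a box of the rectangle that can be
added, and the slide into that box separates the two corners. -/
theorem Kjdt_split (hT : T ∈ INC ν (rectangle a b)) (hR : rectangle a b ≤ ν)
    {XA XB : Finset (ℕ × ℕ)} (h1 : IsRemoval lam₁ lam (XA ∪ XB))
    (hA : XA.Nonempty) (hB : XB.Nonempty) (hrow : ∀ x ∈ XA, ∀ y ∈ XB, x.1 < y.1)
    (huniq : ∀ T₁ T₂, Reach (rectangle a b) T lam₁ T₁ → Reach (rectangle a b) T lam₁ T₂ → T₁ = T₂)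
    {T' : Filling} (hT' : Reach (rectangle a b) T lam₁ T') :
    Kjdt (XA ∪ XB) T' = Kjdt XB (Kjdt XA T') ∧ Kjdt (XA ∪ XB) T' = Kjdt XA (Kjdt XB T') := by
  have hle := hT'.le
  obtain ⟨⟨i, j⟩, hx, hmax⟩ := Finset.exists_max_image XA Prod.fst hA
  have hcx := h1.corner _ (Finset.mem_union_left XB hx)
  obtain ⟨y, hy⟩ := hB
  have hcy := h1.corner _ (Finset.mem_union_right XA hy)
  have hrowlen : lam₁.rowLen (i + 1) ≤ j := by
    by_contra hlt
    exact hcx.2.1 (YoungDiagram.mem_iff_lt_rowLen.2 (not_le.1 hlt))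
  -- The separating box d: the first free box in the row just below the lowest corner of XA.
  have hdadd : IsAddable lam₁ (i + 1, lam₁.rowLen (i + 1)) := by
    refine ⟨fun h => lt_irrefl _ (YoungDiagram.mem_iff_lt_rowLen.1 h), ?_⟩
    rintro ⟨p, q⟩ (h | h) <;> simp only [Prod.mk.injEq] at h
    · exact lam₁.isLowerSet (show (p, q) ≤ (i, j) from ⟨by simp; omega, by simp; omega⟩) hcx.1
    · rw [← h.1, YoungDiagram.mem_iff_lt_rowLen]; omega
  generalize hd : (i + 1, lam₁.rowLen (i + 1)) = d at hdadd
  have hdA : ∀ x ∈ XA, x.1 < d.1 := fun x hx' => by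
    have := hmax x hx'
    rw [← hd]; simp at this ⊢; omega
  have hdB : ∀ y ∈ XB, y.2 < d.2 := fun y hy => by
    rw [← hd]
    have h2 := hrow _ hx y hy
    exact YoungDiagram.mem_iff_lt_rowLen.1 (lam₁.isLowerSet
      (show (i + 1, y.2) ≤ y from ⟨h2, le_rfl⟩) (h1.corner y (Finset.mem_union_right XA hy)).1)
  -- The row of d is at most that of y and its column at most that of (i, j). In a rectangle this
  -- puts d inside; in a general inner shape d might fall outside.
  have hdR : d ∈ rectangle a b := by
    have h2 := mem_rectangle.1 (hle hcx.1)
    have h3 := mem_rectangle.1 (hle hcy.1)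
    have h4 := hrow _ hx y hy
    rw [mem_rectangle, ← hd]
    simp at h2 h3 h4 ⊢
    omega
  obtain ⟨lam₂, hmem, hrem⟩ := exists_isRemoval_of_addable (Y := {d}) (by simpa using hdadd)
  have hle2 : lam₂ ≤ rectangle a b := by
    intro c hc
    rcases (hmem c).1 hc with h | h
    · exact hle h
    · rw [Finset.mem_singleton] at h; exact h ▸ hdR
  obtain ⟨T₂, hT₂⟩ := exists_reach T hle2
  -- Uniqueness at the larger inner shape lets T' be the result of a slide into d, whatever its true
  -- history.
  obtain rfl : T' = Kjdt {d} T₂ := huniq _ _ hT' (.slide _ _ _ _ (by simp) hrem hT₂)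
  obtain ⟨ν₂, hs₂⟩ := hT₂.exists_isSlide hT hR hrem
  have hXX : Disjoint XA XB := Finset.disjoint_left.2 fun x hx hx' => lt_irrefl _ (hrow x hx x hx')
  obtain ⟨ν', hs⟩ := hT'.exists_isSlide hT hR h1
  obtain ⟨lamA, hrA, hrA'⟩ := h1.of_union hXX
  have h1' := h1
  rw [Finset.union_comm] at h1'
  obtain ⟨lamB, hrB, hrB'⟩ := h1'.of_union hXX.symm
  have hsA : IsSlide ν' lam₁ lamA XA (Kjdt {d} T₂) := ⟨hs.inc, hs.le, hrA⟩
  have hsB : IsSlide ν' lam₁ lamB XB (Kjdt {d} T₂) := ⟨hs.inc, hs.le, hrB⟩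
  obtain ⟨νA, hsA'⟩ := (Reach.slide _ _ _ _ hA hrA hT').exists_isSlide hT hR hrA'
  obtain ⟨νB, hsB'⟩ := (Reach.slide _ _ _ _ ⟨y, hy⟩ hrB hT').exists_isSlide hT hR hrB'
  have gA := hs₂.guarded_right hrA.corner
  have gB := hs₂.guarded_left hrB.corner
  have gAB := hs₂.disjoint_regions (Z := XB) hrA.corner
  have mA : ∀ x ∈ XA, x ∈ activePart (Kjdt {d} T₂) XA (rightRegion {d} T₂) := fun x hx =>
    ⟨hs₂.mem_rightRegion (hdA x hx), Or.inr hx⟩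
  have mB : ∀ x ∈ XB, x ∈ activePart (Kjdt {d} T₂) XB (leftRegion {d} T₂) := fun x hx =>
    ⟨hs₂.mem_leftRegion (hdB x hx), Or.inr hx⟩
  refine ⟨hs.Kjdt_union hsA hsA' gA gB gAB mA mB fun x hx => hx.2, ?_⟩
  rw [Finset.union_comm] at hs ⊢
  exact hs.Kjdt_union hsB hsB' gB gA gAB.symm mB mA fun x hx => hx.2

/-- `Kjdt_split` separates the topmost box of X from the others and allows it to be slid into last;
by uniqueness for larger inner shapes, what precedes this slide is irrelevant. -/
theorem exists_Kjdt_eq_single (hT : T ∈ INC ν (rectangle a b)) (hR : rectangle a b ≤ ν)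
    (huniq : ∀ lam₁ T₁ T₂, lam < lam₁ → Reach (rectangle a b) T lam₁ T₁ →
      Reach (rectangle a b) T lam₁ T₂ → T₁ = T₂)
    {X : Finset (ℕ × ℕ)} (hX : X.Nonempty) (h1 : IsRemoval lam₁ lam X) {T' : Filling}
    (hT' : Reach (rectangle a b) T lam₁ T') :
    ∃ x ∈ X, ∀ lam₂ T₂, IsRemoval lam₂ lam {x} → Reach (rectangle a b) T lam₂ T₂ →
      Kjdt X T' = Kjdt {x} T₂ := by
  have hlt : ∀ {lam₁ X}, IsRemoval lam₁ lam X → X.Nonempty → lam < lam₁ := by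
    rintro lam₁ X h ⟨x, hx⟩
    exact lt_of_le_of_ne h.le fun he => (h.addable hx).1 (he ▸ (h.corner x hx).1)
  obtain ⟨x, hx, hmin⟩ := Finset.exists_min_image X Prod.fst hX
  refine ⟨x, hx, fun lam₂ T₂ h2 hT₂ => ?_⟩
  by_cases hne : (X.erase x).Nonempty
  · have hu : {x} ∪ X.erase x = X := by
      rw [← Finset.insert_eq, Finset.insert_erase hx]
    have h1' : IsRemoval lam₁ lam ({x} ∪ X.erase x) := hu.symm ▸ h1
    have hrow : ∀ z ∈ ({x} : Finset (ℕ × ℕ)), ∀ y ∈ X.erase x, z.1 < y.1 := by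
      intro z hz y hy
      rw [Finset.mem_singleton] at hz
      subst hz
      rw [Finset.mem_erase] at hy
      exact lt_of_le_of_ne (hmin y hy.2) ((h1.addable hx).row_ne (h1.addable hy.2) hy.1.symm)
    have := (Kjdt_split hT hR h1' (by simp) hne hrow (huniq _ · · (hlt h1 hX)) hT').2
    rw [hu] at this
    rw [this]
    rw [Finset.union_comm] at h1'
    obtain ⟨lamB, hrB, hrB'⟩ := h1'.of_union (by simp)
    obtain rfl := h2.eq hrB'
    rw [huniq _ _ _ (hlt h2 (by simp)) (.slide _ _ _ _ hne hrB hT') hT₂]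
  · have hX' : X = {x} := by
      rw [Finset.not_nonempty_iff_eq_empty] at hne
      rw [← Finset.insert_erase hx, hne]; rfl
    subst hX'
    obtain rfl := h2.eq h1
    rw [huniq _ _ _ (hlt h2 (by simp)) hT' hT₂]

/-- The tableau of a given inner shape does not depend on the slides that led to it. -/
theorem Reach.unique (hT : T ∈ INC ν (rectangle a b)) (hR : rectangle a b ≤ ν) {T₁ T₂ : Filling}
    (h₁ : Reach (rectangle a b) T lam T₁) (h₂ : Reach (rectangle a b) T lam T₂) : T₁ = T₂ := by
  induction hn : ((rectangle a b).cells \ lam.cells).card using Nat.strong_induction_on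
    generalizing lam T₁ T₂ with
  | _ n ih =>
    have huniq : ∀ lam₁ T₁ T₂, lam < lam₁ → Reach (rectangle a b) T lam₁ T₁ →
        Reach (rectangle a b) T lam₁ T₂ → T₁ = T₂ := by
      intro lam₁ T₁ T₂ hlt h1 h2
      refine ih _ ?_ h1 h2 rfl
      rw [← hn]
      obtain ⟨x, hx1, hx2⟩ := Finset.exists_of_ssubset (YoungDiagram.cells_ssubset_iff.2 hlt)
      refine Finset.card_lt_card ((Finset.ssubset_iff_of_subset
        (Finset.sdiff_subset_sdiff le_rfl hlt.le)).2 ⟨x, ?_, ?_⟩)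
      · exact Finset.mem_sdiff.2 ⟨h1.le hx1, hx2⟩
      · simp [(YoungDiagram.mem_cells x).1 hx1]
    -- A nonempty slide shrinks the inner shape, so the full rectangle is reached only by the empty
    -- sequence.
    have hnot : ∀ {lam₁ X}, IsRemoval lam₁ (rectangle a b) X → X.Nonempty →
        ¬ lam₁ ≤ rectangle a b := by
      rintro lam₁ X h ⟨x, hx⟩ hle
      exact (h.addable hx).1 (hle (h.corner x hx).1)
    cases h₁ with
    | refl =>
      cases h₂ with
      | refl => rfl
      | slide lam₂ _ X₂ T₂' hne₂ hX₂ h₂ => exact absurd h₂.le (hnot hX₂ hne₂)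
    | slide lam₁ _ X₁ T₁' hne₁ hX₁ h₁ =>
      cases h₂ with
      | refl => exact absurd h₁.le (hnot hX₁ hne₁)
      | slide lam₂ _ X₂ T₂' hne₂ hX₂ h₂ =>
        obtain ⟨x₁, hx₁, e₁⟩ := exists_Kjdt_eq_single hT hR huniq hne₁ hX₁ h₁
        obtain ⟨x₂, hx₂, e₂⟩ := exists_Kjdt_eq_single hT hR huniq hne₂ hX₂ h₂
        have a₁ := hX₁.addable hx₁
        have a₂ := hX₂.addable hx₂
        have r₁ := h₁.le (hX₁.corner _ hx₁).1
        have r₂ := h₂.le (hX₂.corner _ hx₂).1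
        have hlam : lam ≤ rectangle a b := hX₁.le.trans h₁.le
        have hR' : ∀ {lam₃ : YoungDiagram} {Y : Finset (ℕ × ℕ)}, (∀ c, c ∈ lam₃ ↔ c ∈ lam ∨ c ∈ Y) →
            (∀ c ∈ Y, c ∈ rectangle a b) → lam₃ ≤ rectangle a b := fun h1 h2 c hc =>
          ((h1 c).1 hc).elim (fun h => hlam h) (h2 c)
        -- Restore both boxes to the inner shape; from there the slides into x and y commute, so the
        -- order of the last two does not matter.
        have key : ∀ x y : ℕ × ℕ, IsAddable lam x → IsAddable lam y → x ∈ rectangle a b →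
            y ∈ rectangle a b → x.1 < y.1 → ∃ lamx lamy Tx Ty, IsRemoval lamx lam {x} ∧
              IsRemoval lamy lam {y} ∧ Reach (rectangle a b) T lamx Tx ∧
              Reach (rectangle a b) T lamy Ty ∧ Kjdt {x} Tx = Kjdt {y} Ty := by
          intro x y hx hy hxR hyR hxy
          obtain ⟨lam₃, hm, h3⟩ := exists_isRemoval_of_addable (lam := lam) (Y := {x} ∪ {y}) (by
            intro z hz
            rcases Finset.mem_union.1 hz with hz | hz <;> rw [Finset.mem_singleton] at hz <;>
              rw [hz] <;> assumption)
          obtain ⟨T₃, hT₃⟩ := exists_reach T (hR' hm (by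
            intro z hz
            rcases Finset.mem_union.1 hz with hz | hz <;> rw [Finset.mem_singleton] at hz <;>
              rw [hz] <;> assumption))
          have hdis : Disjoint ({x} : Finset (ℕ × ℕ)) {y} := by
            rw [Finset.disjoint_singleton]; rintro rfl; exact lt_irrefl _ hxy
          obtain ⟨lamy, hy1, hy2⟩ := h3.of_union hdis
          have h3' := h3
          rw [Finset.union_comm] at h3'
          obtain ⟨lamx, hx1, hx2⟩ := h3'.of_union hdis.symm
          have hs := Kjdt_split hT hR h3 (by simp) (by simp) (by simpa using hxy)
            (huniq _ · · (lt_of_le_of_ne h3.le fun he => hx.1 (he ▸ (hm x).2 (Or.inr (by simp)))))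
            hT₃
          exact ⟨lamx, lamy, _, _, hx2, hy2, .slide _ _ _ _ (by simp) hx1 hT₃,
            .slide _ _ _ _ (by simp) hy1 hT₃, hs.2.symm.trans hs.1⟩
        by_cases hxx : x₁ = x₂
        · subst hxx
          obtain ⟨lam₃, hm, h3⟩ := exists_isRemoval_of_addable (lam := lam) (Y := {x₁})
            (by simpa using a₁)
          obtain ⟨T₃, hT₃⟩ := exists_reach T (hR' hm (by simpa using r₁))
          rw [e₁ _ _ h3 hT₃, e₂ _ _ h3 hT₃]
        · rcases lt_or_gt_of_ne (a₁.row_ne a₂ hxx) with hlt | hlt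
          · obtain ⟨lamx, lamy, Tx, Ty, h1, h2, h3, h4, h5⟩ := key x₁ x₂ a₁ a₂ r₁ r₂ hlt
            rw [e₁ _ _ h1 h3, e₂ _ _ h2 h4, h5]
          · obtain ⟨lamx, lamy, Tx, Ty, h1, h2, h3, h4, h5⟩ := key x₂ x₁ a₂ a₁ r₂ r₁ hlt
            rw [e₁ _ _ h2 h4, e₂ _ _ h1 h3, h5]

theorem KRectifiesTo_unique (hT : T ∈ INC ν (rectangle a b)) (hR : rectangle a b ≤ ν)
    {C C' : Filling} (h : KRectifiesTo (rectangle a b) T C)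
    (h' : KRectifiesTo (rectangle a b) T C') : C = C' :=
  Reach.unique hT hR (.of_KRectifiesTo h .refl) (.of_KRectifiesTo h' .refl)

/-- For the converse: some rectification exists, and uniqueness identifies it with C. -/
theorem KRectifiesTo_iff_reach (hT : T ∈ INC ν (rectangle a b)) (hR : rectangle a b ≤ ν)
    {C : Filling} : KRectifiesTo (rectangle a b) T C ↔ Reach (rectangle a b) T ⊥ C := by
  refine ⟨fun h => .of_KRectifiesTo h .refl, fun h => ?_⟩
  obtain ⟨C', hC'⟩ := exists_KRectifiesTo (rectangle a b) T
  rwa [Reach.unique hT hR h (.of_KRectifiesTo hC' .refl)]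

end Independence

/-! ### Restriction to a set of labels -/

open Classical in
/-- Delete the labels outside `S`. -/
noncomputable def keep (S : Set ℕ) (s : Filling) : Filling := fun c =>
  match s c with
  | Box.label v => if v ∈ S then Box.label v else Box.empty
  | x => x

theorem keep_eq_bullet {S : Set ℕ} {s : Filling} {c : ℕ × ℕ} :
    keep S s c = Box.bullet ↔ s c = Box.bullet := by
  unfold keep
  match s c with
  | Box.empty => simp
  | Box.bullet => simp
  | Box.label v => dsimp only; split_ifs <;> simp

theorem keep_eq_label {S : Set ℕ} {s : Filling} {c : ℕ × ℕ} {v : ℕ} :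
    keep S s c = Box.label v ↔ v ∈ S ∧ s c = Box.label v := by
  unfold keep
  match s c with
  | Box.empty => simp
  | Box.bullet => simp
  | Box.label w =>
    dsimp only
    split_ifs with h
    · simp only [Box.label.injEq]
      constructor
      · rintro rfl; exact ⟨h, rfl⟩
      · exact fun h => h.2
    · simp only [Box.label.injEq, false_iff, not_and]
      rintro hv rfl; exact h hv

theorem Box.ext_symbols {x y : Box} (h1 : x = Box.bullet ↔ y = Box.bullet)
    (h2 : ∀ v, x = Box.label v ↔ y = Box.label v) : x = y := by
  match x with
  | Box.bullet => exact (h1.1 rfl).symm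
  | Box.label v => exact ((h2 v).1 rfl).symm
  | Box.empty =>
    match y with
    | Box.empty => rfl
    | Box.bullet => exact absurd (h1.2 rfl) (by simp)
    | Box.label v => exact absurd ((h2 v).2 rfl) (by simp)

theorem toggle_cases {k : ℕ} {x : Box} (hx : x = Box.bullet ∨ x = Box.label k) :
    (toggle k x = Box.bullet ↔ x = Box.label k) ∧
      ∀ v, toggle k x = Box.label v ↔ v = k ∧ x = Box.bullet := by
  rcases hx with rfl | rfl <;> simp [toggle, eq_comm]

/-- Step k reads and writes only • and k, so it does not notice the deletion of other labels. -/
theorem keep_switch {S : Set ℕ} {k : ℕ} (hk : k ∈ S) (s : Filling) :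
    keep S (switch k s) = switch k (keep S s) := by
  have hiff : ∀ c, (keep S s c = Box.bullet ∨ keep S s c = Box.label k) ↔
      (s c = Box.bullet ∨ s c = Box.label k) := fun c => by
    rw [keep_eq_bullet, keep_eq_label]; tauto
  funext c
  by_cases h : (s c = Box.bullet ∨ s c = Box.label k) ∧
      ∃ d, AdjBoxes c d ∧ (s d = Box.bullet ∨ s d = Box.label k)
  · have h' : (keep S s c = Box.bullet ∨ keep S s c = Box.label k) ∧
      ∃ d, AdjBoxes c d ∧ (keep S s d = Box.bullet ∨ keep S s d = Box.label k) := by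
      simpa only [hiff] using h
    have e1 : switch k s c = toggle k (s c) := by rw [switch, if_pos h]
    have e2 : switch k (keep S s) c = toggle k (keep S s c) := by rw [switch, if_pos h']
    have t1 := toggle_cases h.1
    have t2 := toggle_cases h'.1
    refine Box.ext_symbols ?_ fun v => ?_
    · rw [keep_eq_bullet, e1, e2, t1.1, t2.1, keep_eq_label]; tauto
    · rw [keep_eq_label, e1, e2, t1.2, t2.2, keep_eq_bullet]
      constructor
      · exact fun h => h.2
      · rintro ⟨rfl, h3⟩; exact ⟨hk, rfl, h3⟩
  · have h' : ¬ ((keep S s c = Box.bullet ∨ keep S s c = Box.label k) ∧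
      ∃ d, AdjBoxes c d ∧ (keep S s d = Box.bullet ∨ keep S s d = Box.label k)) := by
      simpa only [hiff] using h
    have e1 : switch k s c = s c := by rw [switch, if_neg h]
    have e2 : switch k (keep S s) c = keep S s c := by rw [switch, if_neg h']
    rw [e2]
    refine Box.ext_symbols ?_ fun v => ?_
    · rw [keep_eq_bullet, keep_eq_bullet, e1]
    · rw [keep_eq_label, keep_eq_label, e1]

theorem run_keep {n k : ℕ} (hk : k ≤ n) (X : Finset (ℕ × ℕ)) (T : Filling) :
    run X (keep (Set.Iic n) T) k = keep (Set.Iic n) (run X T k) := by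
  induction k with
  | zero =>
    funext c
    by_cases hc : c ∈ X
    · rw [run_zero_of_mem hc, keep_eq_bullet.2 (run_zero_of_mem hc)]
    · simp only [run_zero_of_notMem hc, keep]
  | succ k ih =>
    rw [run_succ, run_succ, ih (by omega), keep_switch (Set.mem_Iic.2 hk)]

theorem exists_keep_mem_INC {ν lam : YoungDiagram} {T : Filling} (hT : T ∈ INC ν lam)
    (hle : lam ≤ ν) (n : ℕ) : ∃ ν', keep (Set.Iic n) T ∈ INC ν' lam ∧ lam ≤ ν' := by
  classical
  let ν' : YoungDiagram := ⟨ν.cells.filter fun c => c ∈ lam ∨ ∃ v ≤ n, T c = Box.label v, by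
    intro c d hdc hc
    simp only [Finset.coe_filter, YoungDiagram.mem_cells, Set.mem_ofPred_eq] at hc ⊢
    refine ⟨ν.isLowerSet hdc hc.1, ?_⟩
    by_cases hd : d ∈ lam
    · exact Or.inl hd
    · right
      have hcl : c ∉ lam := fun h => hd (lam.isLowerSet hdc h)
      obtain ⟨v, hv, hcv⟩ := hc.2.resolve_left hcl
      -- Labels are compared along the hook from d through (d.1, c.2) to c, which stays inside the
      -- skew shape.
      have hle' : (d.1, c.2) ≤ c := ⟨hdc.1, le_rfl⟩
      have hle'' : d ≤ (d.1, c.2) := ⟨le_rfl, hdc.2⟩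
      obtain ⟨u, hu⟩ := (INC.label_iff hT).2 ⟨ν.isLowerSet hdc hc.1, hd⟩
      obtain ⟨w, hw⟩ := (INC.label_iff hT (c := (d.1, c.2))).2
        ⟨ν.isLowerSet hle' hc.1, fun h => hd (lam.isLowerSet hle'' h)⟩
      have h1 : u ≤ w := by
        rcases lt_or_eq_of_le hdc.2 with h | h
        · exact (hT.2.2.1 d.1 d.2 c.2 u w h hu hw).le
        · rw [← h] at hw
          rw [show T (d.1, d.2) = T d from rfl, hu] at hw; cases hw; rfl
      have h2 : w ≤ v := by
        rcases lt_or_eq_of_le hdc.1 with h | h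
        · exact (hT.2.2.2 d.1 c.1 c.2 w v h hw hcv).le
        · rw [h] at hw
          rw [show T (c.1, c.2) = T c from rfl, hcv] at hw; cases hw; rfl
      exact ⟨u, (h1.trans h2).trans hv, hu⟩⟩
  have hmem : ∀ c, c ∈ ν' ↔ c ∈ ν ∧ (c ∈ lam ∨ ∃ v ≤ n, T c = Box.label v) := fun c => by
    rw [← YoungDiagram.mem_cells]; simp [ν']
  refine ⟨ν', mem_INC_of_next ?_ ?_ ?_, fun c hc => (hmem c).2 ⟨hle hc, Or.inl hc⟩⟩
  · intro c hc hcl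
    obtain ⟨v, hv, hcv⟩ := ((hmem c).1 hc).2.resolve_left hcl
    exact ⟨v, INC.pos hT hcv, keep_eq_label.2 ⟨hv, hcv⟩⟩
  · intro c hc
    match hs : keep (Set.Iic n) T c with
    | Box.empty => rfl
    | Box.bullet => exact absurd (keep_eq_bullet.1 hs) (INC.ne_bullet hT c)
    | Box.label v =>
      obtain ⟨h1, h2⟩ := keep_eq_label.1 hs
      have := (INC.label_iff hT).1 ⟨v, h2⟩
      exact absurd ⟨(hmem c).2 ⟨this.1, Or.inr ⟨v, h1, h2⟩⟩, this.2⟩ hc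
  · intro c d p q hcd hp hq
    exact INC.lt hT hcd (keep_eq_label.1 hp).2 (keep_eq_label.1 hq).2

theorem IsSlide.Kjdt_keep {ν lam lam' : YoungDiagram} {X : Finset (ℕ × ℕ)} {T : Filling}
    (h : IsSlide ν lam lam' X T) (n : ℕ) :
    Kjdt X (keep (Set.Iic n) T) = keep (Set.Iic n) (Kjdt X T) := by
  obtain ⟨ν', h1, h2⟩ := exists_keep_mem_INC h.inc h.le n
  have hs : IsSlide ν' lam lam' X (keep (Set.Iic n) T) := ⟨h1, h2, h.rem⟩
  obtain ⟨N, hN⟩ := h.exists_bound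
  have hN' : ∀ x v, T x = Box.label v → v ≤ max n N := fun x v hx =>
    (hN x v hx).trans (le_max_right _ _)
  -- For the restricted tableau the slide ends after step n; in the full run the labels up to n no
  -- longer move after that.
  have e1 := hs.Kjdt_eq (N := n) fun x v hx => (keep_eq_label.1 hx).1
  funext x
  have hb : ∀ s : Filling, eraseBullets s x ≠ Box.bullet := fun s => by
    unfold eraseBullets
    match s x with
    | Box.empty => simp
    | Box.bullet => simp
    | Box.label v => simp
  refine Box.ext_symbols ?_ fun v => ?_
  · rw [keep_eq_bullet, Kjdt, Kjdt]
    exact iff_of_false (hb _) (hb _)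
  · rw [e1, eraseBullets_eq_label, run_keep le_rfl, keep_eq_label, keep_eq_label,
      h.Kjdt_label_iff hN']
    refine and_congr_right fun hv => run_label_iff_of_le hv ((Set.mem_Iic.1 hv).trans ?_)
    exact le_max_left _ _

/-- Discarding large labels leaves the inner shape unchanged, so the same sequence of slides remains
available and commutes with the restriction. -/
theorem KRectifiesTo.keep {ν lam : YoungDiagram} {T C : Filling} (h : KRectifiesTo lam T C)
    (hT : T ∈ INC ν lam) (hle : lam ≤ ν) (n : ℕ) :
    KRectifiesTo lam (keep (Set.Iic n) T) (keep (Set.Iic n) C) := by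
  induction h generalizing ν with
  | done T => exact .done _
  | slide lam lam' X T C hne hX hlam' h ih =>
    have hs : IsSlide ν lam lam' X T := ⟨hT, hle, hX, hlam'⟩
    obtain ⟨ν', h1, h2⟩ := hs.exists_Kjdt_mem_INC
    refine .slide _ _ X _ _ hne hX hlam' ?_
    rw [hs.Kjdt_keep]
    exact ih h1 h2

theorem KRectifiesTo.exists_label_iff {ν lam : YoungDiagram} {T C : Filling}
    (h : KRectifiesTo lam T C) (hT : T ∈ INC ν lam) (hle : lam ≤ ν) (v : ℕ) :
    (∃ x, C x = Box.label v) ↔ ∃ x, T x = Box.label v := by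
  induction h generalizing ν with
  | done T => rfl
  | slide lam lam' X T C hne hX hlam' h ih =>
    have hs : IsSlide ν lam lam' X T := ⟨hT, hle, hX, hlam'⟩
    obtain ⟨ν', h1, h2⟩ := hs.exists_Kjdt_mem_INC
    rw [ih h1 h2, hs.exists_Kjdt_label_iff]

/-- The labels above `n` before a slide are determined by the labels above `n` and the positions of
the bullets after it. -/
theorem label_iff_of_Kjdt {ν₁ ν₂ lam lam' : YoungDiagram} {X : Finset (ℕ × ℕ)} {T₁ T₂ : Filling}
    (h₁ : IsSlide ν₁ lam lam' X T₁) (h₂ : IsSlide ν₂ lam lam' X T₂) {n N : ℕ} (hnN : n ≤ N)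
    (hN₁ : ∀ x v, T₁ x = Box.label v → v ≤ N) (hN₂ : ∀ x v, T₂ x = Box.label v → v ≤ N)
    (hb : ∀ x, run X T₁ N x = Box.bullet ↔ run X T₂ N x = Box.bullet)
    (hl : ∀ x v, n < v → (Kjdt X T₁ x = Box.label v ↔ Kjdt X T₂ x = Box.label v))
    {x : ℕ × ℕ} {v : ℕ} (hv : n < v) : T₁ x = Box.label v ↔ T₂ x = Box.label v := by
  -- Run the slide backwards from N to n: each step is an involution that involves only bullets and
  -- a label above n.
  have key : ∀ k, n ≤ k → k ≤ N → keep (Set.Ioi n) (run X T₁ k) = keep (Set.Ioi n) (run X T₂ k) := by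
    intro k hk hkN
    induction hkN using Nat.decreasingInduction with
    | self =>
      funext x
      refine Box.ext_symbols ?_ fun v => ?_
      · rw [keep_eq_bullet, keep_eq_bullet, hb]
      · rw [keep_eq_label, keep_eq_label, ← h₁.Kjdt_label_iff hN₁, ← h₂.Kjdt_label_iff hN₂]
        exact and_congr_right (hl x v)
    | of_succ k hkN ih =>
      have h := ih (by omega)
      rw [run_succ, run_succ, keep_switch (by simp; omega), keep_switch (by simp; omega)] at h
      rw [← switch_switch (k + 1) (keep _ (run X T₁ k)), h, switch_switch]
  have h := congrFun (key n le_rfl hnN) x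
  have key2 : ∀ {ν T}, IsSlide ν lam lam' X T →
      (T x = Box.label v ↔ keep (Set.Ioi n) (run X T n) x = Box.label v) := by
    intro ν T h
    rw [keep_eq_label, run_label_iff_of_lt hv]
    exact ⟨fun hx => ⟨hv, h.notMem_of_label hx, hx⟩, fun hx => hx.2.2⟩
  rw [key2 h₁, key2 h₂, h]

/-! ### Rectangles minus rectangles -/

/-- The outer shape of the tableau that is left of a tableau of shape
`rectangle (a + A) (b + B) / rectangle a b` when the inner shape has become `lam`: the boxes that
have been filled are removed from the opposite corner. -/
def outerShape (a b A B : ℕ) (lam : YoungDiagram) : YoungDiagram where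
  cells := (rectangle (a + A) (b + B)).cells.filter fun c =>
    A ≤ c.1 → B ≤ c.2 → (c.1 - A, c.2 - B) ∈ lam
  isLowerSet := by
    intro c d hdc hc
    simp only [Finset.coe_filter, YoungDiagram.mem_cells, Set.mem_ofPred_eq] at hc ⊢
    refine ⟨(rectangle _ _).isLowerSet hdc hc.1, fun h1 h2 => ?_⟩
    exact lam.isLowerSet (show (d.1 - A, d.2 - B) ≤ (c.1 - A, c.2 - B) from
      ⟨Nat.sub_le_sub_right hdc.1 _, Nat.sub_le_sub_right hdc.2 _⟩)
      (hc.2 (h1.trans hdc.1) (h2.trans hdc.2))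

theorem mem_outerShape {a b A B : ℕ} {lam : YoungDiagram} {c : ℕ × ℕ} :
    c ∈ outerShape a b A B lam ↔ c ∈ rectangle (a + A) (b + B) ∧
      (A ≤ c.1 → B ≤ c.2 → (c.1 - A, c.2 - B) ∈ lam) := by
  rw [← YoungDiagram.mem_cells]
  simp [outerShape]

theorem outerShape_rectangle (a b A B : ℕ) :
    outerShape a b A B (rectangle a b) = rectangle (a + A) (b + B) := by
  refine SetLike.ext fun c => ?_
  rw [mem_outerShape]
  simp only [mem_rectangle]
  omega

theorem rectangle_le_rectangle (a b A B : ℕ) :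
    rectangle a b ≤ rectangle (a + A) (b + B) := by
  intro c hc
  rw [mem_rectangle] at hc ⊢
  omega

theorem mem_outerShape_of_removal {a b A B : ℕ} {lam lam' : YoungDiagram} {d : ℕ × ℕ}
    (h : IsRemoval lam lam' {d}) {x : ℕ × ℕ} :
    x ∈ outerShape a b A B lam' ↔ x ∈ outerShape a b A B lam ∧ x ≠ (d.1 + A, d.2 + B) := by
  simp only [mem_outerShape, h.mem_iff, Finset.mem_singleton]
  obtain ⟨x1, x2⟩ := x
  obtain ⟨d1, d2⟩ := d
  simp only [Prod.mk.injEq, ne_eq]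
  constructor
  · rintro ⟨h1, h2⟩
    refine ⟨⟨h1, fun h3 h4 => (h2 h3 h4).1⟩, ?_⟩
    rintro ⟨rfl, rfl⟩
    exact (h2 (by omega) (by omega)).2 ⟨by omega, by omega⟩
  · rintro ⟨⟨h1, h2⟩, h3⟩
    exact ⟨h1, fun h4 h5 => ⟨h2 h4 h5, fun h6 => h3 ⟨by omega, by omega⟩⟩⟩

section

variable {a b A B : ℕ} {lam lam' : YoungDiagram} {T T' : Filling} {d : ℕ × ℕ}

/-- Let `T'` have the shape that is expected for the inner shape `lam`, and let it have arisen by a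
slide into a box `e` below `d` or to the right of `d` that moved the bullet to its expected place.
Then the next slide, into `d`, cannot move bullets past that place. -/
theorem final_bound {lam₂ : YoungDiagram} {e : ℕ × ℕ} {T₂ : Filling}
    (h₂ : IsSlide (outerShape a b A B lam₂) lam₂ lam {e} T₂)
    (h : IsSlide (outerShape a b A B lam) lam lam' {d} (Kjdt {e} T₂)) {N : ℕ}
    (he : Visited {e} T₂ (e.1 + A, e.2 + B)) {x : ℕ × ℕ}
    (hx : run {d} (Kjdt {e} T₂) N x = Box.bullet) :
    (d.1 < e.1 → x.1 < e.1 + A) ∧ (d.2 < e.2 → x.2 < e.2 + B) := by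
  have hxres := (h.mem_of_bullet hx).1
  have hcor : ∀ y ∈ ({d} : Finset (ℕ × ℕ)), IsInnerCorner lam y := h.rem.corner
  -- The box e has been vacated, so e + (A, B) and everything southeast of it is missing from the
  -- outer shape.
  have hnot : ¬ (e.1 + A ≤ x.1 ∧ e.2 + B ≤ x.2) := by
    rintro ⟨h1, h2⟩
    have := (mem_outerShape.1 hxres).2 (by omega) (by omega)
    have h3 := lam.isLowerSet (show e ≤ (x.1 - A, x.2 - B) from
      ⟨by simp; omega, by simp; omega⟩) this
    exact (h₂.rem.addable (by simp)).1 h3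
  constructor
  · intro hlt
    have g := h₂.guarded_right hcor
    have hxA : x ∈ activePart (Kjdt {e} T₂) {d} (rightRegion {e} T₂) := by
      simpa using h.bullet_mem_of_guarded g g (fun y hy => by
        rw [Finset.mem_singleton] at hy
        exact Or.inl ⟨hy ▸ h₂.mem_rightRegion hlt, Or.inr (by simp [hy])⟩) hx
    by_contra h1
    exact hnot ⟨not_lt.1 h1, hxA.1 _ he (not_lt.1 h1)⟩
  · intro hlt
    have g := h₂.guarded_left hcor
    have hxA : x ∈ activePart (Kjdt {e} T₂) {d} (leftRegion {e} T₂) := by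
      simpa using h.bullet_mem_of_guarded g g (fun y hy => by
        rw [Finset.mem_singleton] at hy
        exact Or.inl ⟨hy ▸ h₂.mem_leftRegion hlt, Or.inr (by simp [hy])⟩) hx
    by_contra h1
    exact hnot ⟨hxA.1 _ he (not_lt.1 h1), not_lt.1 h1⟩

/-- A previous slide into such a box e provides the barrier, in `final_bound`, that stops the slide
into d at row d.1 + A. -/
theorem exists_addable_below (hle : lam ≤ rectangle a b) (hd : IsInnerCorner lam d)
    (hda : d.1 + 1 < a) : ∃ e, IsAddable lam e ∧ e ∈ rectangle a b ∧ e.1 = d.1 + 1 := by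
  have hlen : lam.rowLen (d.1 + 1) ≤ d.2 := by
    by_contra hlt
    exact hd.2.1 (YoungDiagram.mem_iff_lt_rowLen.2 (not_le.1 hlt))
  have hdR := mem_rectangle.1 (hle hd.1)
  refine ⟨(d.1 + 1, lam.rowLen (d.1 + 1)), ⟨?_, ?_⟩, mem_rectangle.2 ⟨hda, by simp; omega⟩, rfl⟩
  · exact fun h => lt_irrefl _ (YoungDiagram.mem_iff_lt_rowLen.1 h)
  · rintro ⟨p, q⟩ (h | h) <;> simp only [Prod.mk.injEq] at h
    · exact lam.isLowerSet (show (p, q) ≤ d from ⟨by simp; omega, by simp; omega⟩) hd.1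
    · rw [← h.1, YoungDiagram.mem_iff_lt_rowLen]; omega

theorem exists_addable_right (hle : lam ≤ rectangle a b) (hd : IsInnerCorner lam d)
    (hdb : d.2 + 1 < b) : ∃ e, IsAddable lam e ∧ e ∈ rectangle a b ∧ e.2 = d.2 + 1 := by
  have hlen : lam.colLen (d.2 + 1) ≤ d.1 := by
    by_contra hlt
    exact hd.2.2 (YoungDiagram.mem_iff_lt_colLen.2 (not_le.1 hlt))
  have hdR := mem_rectangle.1 (hle hd.1)
  refine ⟨(lam.colLen (d.2 + 1), d.2 + 1), ⟨?_, ?_⟩, mem_rectangle.2 ⟨by simp; omega, hdb⟩, rfl⟩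
  · exact fun h => lt_irrefl _ (YoungDiagram.mem_iff_lt_colLen.1 h)
  · rintro ⟨p, q⟩ (h | h) <;> simp only [Prod.mk.injEq] at h
    · rw [← h.2, YoungDiagram.mem_iff_lt_colLen]; omega
    · exact lam.isLowerSet (show (p, q) ≤ d from ⟨by simp; omega, by simp; omega⟩) hd.1

/-- A slide starting from a tableau whose outer shape is a rectangle vacates the box opposite to
the box that it fills. -/
theorem Reach.mem_INC_outerShape (hT : T ∈ INC (rectangle (a + A) (b + B)) (rectangle a b))
    (h : Reach (rectangle a b) T lam T') :
    T' ∈ INC (outerShape a b A B lam) lam ∧ lam ≤ outerShape a b A B lam ∧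
      ∀ d lam', IsRemoval lam lam' {d} → ∀ N, (∀ x v, T' x = Box.label v → v ≤ N) →
        ∀ x, run {d} T' N x = Box.bullet ↔ x = (d.1 + A, d.2 + B) := by
  have hR := rectangle_le_rectangle a b A B
  induction hn : ((rectangle a b).cells \ lam.cells).card using Nat.strong_induction_on
    generalizing lam T' with
  | _ n ih =>
    -- By uniqueness T' is the result of a slide into any addable box e of R, and the induction
    -- hypothesis says where that slide ended.
    have hprev : ∀ e, IsAddable lam e → e ∈ rectangle a b → ∃ lam₂ T₂,
        IsSlide (outerShape a b A B lam₂) lam₂ lam {e} T₂ ∧ T' = Kjdt {e} T₂ ∧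
        ∀ N, (∀ x v, T₂ x = Box.label v → v ≤ N) →
          ∀ x, run {e} T₂ N x = Box.bullet ↔ x = (e.1 + A, e.2 + B) := by
      intro e he heR
      obtain ⟨lam₂, hm, hrem⟩ := exists_isRemoval_of_addable (Y := {e}) (by simpa using he)
      have hle : lam₂ ≤ rectangle a b := fun c hc => ((hm c).1 hc).elim (fun h' => h.le h')
        fun h' => by rw [Finset.mem_singleton] at h'; exact h' ▸ heR
      obtain ⟨T₂, hT₂⟩ := exists_reach T hle
      obtain ⟨h1, h2, h3⟩ := ih _ (hn ▸ hrem.card_lt (by simp) hle) hT₂ rfl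
      exact ⟨lam₂, T₂, ⟨h1, h2, hrem⟩,
        Reach.unique hT hR h (.slide _ _ _ _ (by simp) hrem hT₂), h3 e lam hrem⟩
    have hinc : T' ∈ INC (outerShape a b A B lam) lam ∧
        lam ≤ outerShape a b A B lam := by
      by_cases hne : lam = rectangle a b
      · subst hne
        rw [outerShape_rectangle, Reach.unique hT hR h .refl]
        exact ⟨hT, hR⟩
      · obtain ⟨e, lam₂, hle, hrem⟩ := exists_add_box h.le hne
        obtain ⟨lam₃, T₂, hs, rfl, hb⟩ := hprev e (hrem.addable (by simp))
          (hle (hrem.corner e (by simp)).1)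
        obtain ⟨N, hN⟩ := hs.exists_bound
        refine hs.Kjdt_mem_INC hN fun x => ?_
        rw [mem_outerShape_of_removal hs.rem, ne_eq, ne_eq, hb N hN]
    refine ⟨hinc.1, hinc.2, fun d lam' hrem N hN => ?_⟩
    have hs : IsSlide (outerShape a b A B lam) lam lam' {d} T' := ⟨hinc.1, hinc.2, hrem⟩
    have hd := hrem.corner d (by simp)
    have hdR := mem_rectangle.1 (h.le hd.1)
    have key : ∀ x, run {d} T' N x = Box.bullet → x = (d.1 + A, d.2 + B) := by
      intro x hx
      have hxmem := mem_rectangle.1 (mem_outerShape.1 (hs.mem_of_bullet hx).1).1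
      have hvis : ∀ e, IsAddable lam e → e ∈ rectangle a b →
          (d.1 < e.1 → x.1 < e.1 + A) ∧ (d.2 < e.2 → x.2 < e.2 + B) := by
        intro e he heR
        obtain ⟨lam₂, T₂, hs₂, rfl, hb⟩ := hprev e he heR
        obtain ⟨M, hM⟩ := hs₂.exists_bound
        exact final_bound hs₂ hs ⟨M, (hb M hM _).2 rfl⟩ hx
      -- If d is in the last row of R, the boundary of the large rectangle is the barrier; otherwise
      -- it is the track of a slide into the next row.
      have hx1 : x.1 ≤ d.1 + A := by
        by_cases hda : d.1 + 1 < a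
        · obtain ⟨e, he, heR, he1⟩ := exists_addable_below h.le hd hda
          have := (hvis e he heR).1 (by omega)
          omega
        · omega
      have hx2 : x.2 ≤ d.2 + B := by
        by_cases hdb : d.2 + 1 < b
        · obtain ⟨e, he, heR, he1⟩ := exists_addable_right h.le hd hdb
          have := (hvis e he heR).2 (by omega)
          omega
        · omega
      -- The box d + (A, B) belongs to the outer shape, and a final bullet is a corner of that shape
      -- weakly northwest of it.
      refine (hs.isInnerCorner_of_final hN hx).eq_of_le ?_ ⟨hx1, hx2⟩
      rw [mem_outerShape, mem_rectangle]
      refine ⟨⟨by simp; omega, by simp; omega⟩, fun _ _ => ?_⟩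
      simpa using hd.1
    intro x
    refine ⟨key x, ?_⟩
    rintro rfl
    obtain ⟨e, -, he⟩ := hs.exists_final hN (S := Set.univ) (p := d)
      (visited_of_mem (by simp)) trivial (fun _ _ _ _ _ => trivial)
    have := key e he
    rwa [this] at he

/-- The labels above `n` of a tableau are determined by those of its rectification. -/
theorem label_iff_of_reach {T₁ T₂ T₁' T₂' : Filling} {n N : ℕ} (hnN : n ≤ N)
    (hT₁ : T₁ ∈ INC (rectangle (a + A) (b + B)) (rectangle a b))
    (hT₂ : T₂ ∈ INC (rectangle (a + A) (b + B)) (rectangle a b))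
    (h₁ : Reach (rectangle a b) T₁ lam T₁') (h₂ : Reach (rectangle a b) T₂ lam T₂')
    (hN₁ : ∀ x v, T₁' x = Box.label v → v ≤ N) (hN₂ : ∀ x v, T₂' x = Box.label v → v ≤ N)
    (hl : ∀ x v, n < v → (T₁' x = Box.label v ↔ T₂' x = Box.label v)) :
    ∀ x v, n < v → (T₁ x = Box.label v ↔ T₂ x = Box.label v) := by
  have hR := rectangle_le_rectangle a b A B
  induction hn : ((rectangle a b).cells \ lam.cells).card using Nat.strong_induction_on
    generalizing lam T₁' T₂' with
  | _ m ih =>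
    by_cases hne : lam = rectangle a b
    · subst hne
      rw [Reach.unique hT₁ hR h₁ .refl, Reach.unique hT₂ hR h₂ .refl] at hl
      exact hl
    · obtain ⟨e, lam₂, hle, hrem⟩ := exists_add_box h₁.le hne
      obtain ⟨S₁, hS₁⟩ := exists_reach T₁ hle
      obtain ⟨S₂, hS₂⟩ := exists_reach T₂ hle
      -- Both histories may be assumed to end with the slide into the same box e.
      obtain rfl := Reach.unique hT₁ hR h₁ (.slide _ _ _ _ (by simp) hrem hS₁)
      obtain rfl := Reach.unique hT₂ hR h₂ (.slide _ _ _ _ (by simp) hrem hS₂)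
      obtain ⟨i₁, l₁, b₁⟩ := hS₁.mem_INC_outerShape hT₁
      obtain ⟨i₂, l₂, b₂⟩ := hS₂.mem_INC_outerShape hT₂
      have s₁ : IsSlide _ lam₂ lam {e} S₁ := ⟨i₁, l₁, hrem⟩
      have s₂ : IsSlide _ lam₂ lam {e} S₂ := ⟨i₂, l₂, hrem⟩
      have n₁ : ∀ x v, S₁ x = Box.label v → v ≤ N := fun x v hx => by
        obtain ⟨y, hy⟩ := s₁.exists_Kjdt_label_iff.2 ⟨x, hx⟩
        exact hN₁ y v hy
      have n₂ : ∀ x v, S₂ x = Box.label v → v ≤ N := fun x v hx => by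
        obtain ⟨y, hy⟩ := s₂.exists_Kjdt_label_iff.2 ⟨x, hx⟩
        exact hN₂ y v hy
      refine ih _ (hn ▸ hrem.card_lt (by simp) hle) hS₁ hS₂ n₁ n₂ (fun x v hv => ?_) rfl
      -- The final bullets agree, since both slides end exactly at e + (A, B).
      exact label_iff_of_Kjdt s₁ s₂ hnN n₁ n₂
        (fun x => (b₁ e lam hrem N n₁ x).trans (b₂ e lam hrem N n₂ x).symm) hl hv

end

/-! ### Rectification as a bijection -/

theorem INC.ext {ν lam ν' lam' : YoungDiagram} {T T' : Filling} (hT : T ∈ INC ν lam)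
    (hT' : T' ∈ INC ν' lam') (h : ∀ x v, T x = Box.label v ↔ T' x = Box.label v) : T = T' :=
  funext fun x => Box.ext_symbols
    (iff_of_false (INC.ne_bullet hT x) (INC.ne_bullet hT' x)) (h x)

theorem finite_INC_le (ν lam : YoungDiagram) (N : ℕ) :
    {T | T ∈ INC ν lam ∧ ∀ x v, T x = Box.label v → v ≤ N}.Finite := by
  let code : Box → ℕ := fun y => match y with | Box.label v => v | _ => 0
  let f : Filling → (ν.cells → Fin (N + 1)) := fun T c =>
    ⟨min (code (T c)) N, Nat.lt_succ_of_le (min_le_right _ _)⟩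
  refine Set.Finite.of_injOn (f := f) (t := Set.univ) (fun _ _ => trivial) ?_ Set.finite_univ
  rintro T ⟨hT, hN⟩ T' ⟨hT', hN'⟩ h
  have key : ∀ {T T' : Filling}, T ∈ INC ν lam → (∀ x v, T x = Box.label v → v ≤ N) →
      T' ∈ INC ν lam → (∀ x v, T' x = Box.label v → v ≤ N) → f T = f T' →
      ∀ x v, T x = Box.label v → T' x = Box.label v := by
    intro T T' hT hN hT' hN' h x v hx
    have hmem := (INC.label_iff hT).1 ⟨v, hx⟩
    obtain ⟨w, hw⟩ := (INC.label_iff hT').2 hmem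
    have := congrArg Fin.val (congrFun h ⟨x, hmem.1⟩)
    simp only [f, code, hx, hw, min_eq_left (hN x v hx), min_eq_left (hN' x w hw)] at this
    rw [hw, this]
  exact INC.ext hT hT' fun x v => ⟨key hT hN hT' hN' h x v, key hT' hN' hT hN h.symm x v⟩

section Rotation

variable {a b A B N : ℕ}

/-- The half turn of the rectangle with `m` rows and `n` columns. -/
def halfTurn (m n : ℕ) (c : ℕ × ℕ) : ℕ × ℕ := (m - 1 - c.1, n - 1 - c.2)

open Classical in
/-- Rotate a tableau by a half turn, and complement its labels. -/
noncomputable def rotated (a b A B N : ℕ) (K : Filling) : Filling := fun c =>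
  if c ∈ rectangle (a + A) (b + B) ∧ c ∉ rectangle a b then
    match K (halfTurn (a + A) (b + B) c) with
    | Box.label v => Box.label (N + 1 - v)
    | x => x
  else Box.empty

theorem mem_outerShape_bot {c : ℕ × ℕ} :
    c ∈ outerShape a b A B ⊥ ↔ c ∈ rectangle (a + A) (b + B) ∧ ¬ (A ≤ c.1 ∧ B ≤ c.2) := by
  rw [mem_outerShape]
  have := YoungDiagram.notMem_bot (c.1 - A, c.2 - B)
  tauto

theorem halfTurn_mem {c : ℕ × ℕ} (hc : c ∈ rectangle (a + A) (b + B) ∧ c ∉ rectangle a b) :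
    halfTurn (a + A) (b + B) c ∈ outerShape a b A B ⊥ := by
  rw [mem_outerShape_bot]
  simp only [mem_rectangle, halfTurn] at hc ⊢
  omega

theorem rotated_eq {K : Filling} (hK : K ∈ INC (outerShape a b A B ⊥) ⊥) {c : ℕ × ℕ}
    (hc : c ∈ rectangle (a + A) (b + B) ∧ c ∉ rectangle a b) :
    ∃ v, K (halfTurn (a + A) (b + B) c) = Box.label v ∧
      rotated a b A B N K c = Box.label (N + 1 - v) := by
  obtain ⟨v, hv⟩ := (INC.label_iff hK).2 ⟨halfTurn_mem hc, YoungDiagram.notMem_bot _⟩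
  refine ⟨v, hv, ?_⟩
  rw [rotated, if_pos hc, hv]

/-- The half turn and v ↦ N + 1 − v both reverse the order, so strict increase is preserved, and
labels stay between 1 and N. -/
theorem rotated_mem {K : Filling} (hK : K ∈ INC (outerShape a b A B ⊥) ⊥)
    (hN : ∀ x v, K x = Box.label v → v ≤ N) :
    rotated a b A B N K ∈ INC (rectangle (a + A) (b + B)) (rectangle a b) ∧
      ∀ x v, rotated a b A B N K x = Box.label v → v ≤ N := by
  have key : ∀ c v, rotated a b A B N K c = Box.label v →
      c ∈ rectangle (a + A) (b + B) ∧ c ∉ rectangle a b := by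
    intro c v h
    by_contra hc
    rw [rotated, if_neg hc] at h
    cases h
  refine ⟨mem_INC_of_next ?_ ?_ ?_, ?_⟩
  · intro c h1 h2
    obtain ⟨v, hv, hv'⟩ := rotated_eq (N := N) hK ⟨h1, h2⟩
    exact ⟨_, by have := hN _ _ hv; omega, hv'⟩
  · intro c hc
    rw [rotated, if_neg hc]
  · intro c d m n hcd hm hn
    have hc := key c m hm
    have hd := key d n hn
    obtain ⟨v, hv, hv'⟩ := rotated_eq (N := N) hK hc
    obtain ⟨w, hw, hw'⟩ := rotated_eq (N := N) hK hd
    have hnext : NextBox (halfTurn (a + A) (b + B) d) (halfTurn (a + A) (b + B) c) := by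
      have h3 := mem_rectangle.1 hd.1
      rcases hcd with rfl | rfl
      · left; dsimp only [halfTurn] at h3 ⊢; rw [Prod.mk.injEq]; omega
      · right; dsimp only [halfTurn] at h3 ⊢; rw [Prod.mk.injEq]; omega
    have h4 := INC.lt hK hnext hw hv
    have h5 := hN _ _ hv
    rw [hm] at hv'
    rw [hn] at hw'
    simp only [Box.label.injEq] at hv' hw'
    omega
  · intro c v hc
    obtain ⟨w, hw, hw'⟩ := rotated_eq (N := N) hK (key c v hc)
    rw [hc] at hw'
    have := INC.pos hK hw
    simp only [Box.label.injEq] at hw'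
    omega

theorem rotated_injOn {K K' : Filling} (hK : K ∈ INC (outerShape a b A B ⊥) ⊥)
    (hN : ∀ x v, K x = Box.label v → v ≤ N) (hK' : K' ∈ INC (outerShape a b A B ⊥) ⊥)
    (hN' : ∀ x v, K' x = Box.label v → v ≤ N)
    (h : rotated a b A B N K = rotated a b A B N K') : K = K' := by
  have key : ∀ c, c ∈ outerShape a b A B ⊥ → K c = K' c := by
    intro c hc
    have h1 := mem_outerShape_bot.1 hc
    have h2 := mem_rectangle.1 h1.1
    have h3 : halfTurn (a + A) (b + B) (halfTurn (a + A) (b + B) c) = c := by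
      ext <;> simp only [halfTurn] <;> omega
    have h4 : halfTurn (a + A) (b + B) c ∈ rectangle (a + A) (b + B) ∧
        halfTurn (a + A) (b + B) c ∉ rectangle a b := by
      simp only [mem_rectangle, halfTurn]; omega
    obtain ⟨v, hv, hv'⟩ := rotated_eq (N := N) hK h4
    obtain ⟨w, hw, hw'⟩ := rotated_eq (N := N) hK' h4
    rw [h3] at hv hw
    rw [h, hw', Box.label.injEq] at hv'
    have := hN _ _ hv
    have := hN' _ _ hw
    rw [hv, hw, Box.label.injEq]
    omega
  funext c
  by_cases hc : c ∈ outerShape a b A B ⊥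
  · exact key c hc
  · rw [hK.2.1 c fun h => hc h.1, hK'.2.1 c fun h => hc h.1]

/-- Rectification is injective on the tableaux whose outer shape is a rectangle. -/
theorem rectification_injective {T T' K : Filling}
    (hT : T ∈ INC (rectangle (a + A) (b + B)) (rectangle a b))
    (hT' : T' ∈ INC (rectangle (a + A) (b + B)) (rectangle a b))
    (h : Reach (rectangle a b) T ⊥ K) (h' : Reach (rectangle a b) T' ⊥ K) : T = T' := by
  have hK := (h.mem_INC_outerShape hT).1
  refine INC.ext hT hT' fun x v => ?_
  rcases Nat.eq_zero_or_pos v with rfl | hv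
  · exact iff_of_false (fun hx => by simpa using INC.pos hT hx)
      (fun hx => by simpa using INC.pos hT' hx)
  -- With threshold 0 every label counts as large.
  · exact label_iff_of_reach (Nat.zero_le (maxLabel K)) hT hT' h h'
      (fun _ _ hx => INC.le_maxLabel hK hx) (fun _ _ hx => INC.le_maxLabel hK hx)
      (fun _ _ _ => Iff.rfl) x v hv

theorem Reach.exists_label_iff {R ν lam : YoungDiagram} {T T' : Filling}
    (h : Reach R T lam T') (hT : T ∈ INC ν R) (hR : R ≤ ν) (v : ℕ) :
    (∃ x, T' x = Box.label v) ↔ ∃ x, T x = Box.label v := by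
  induction h with
  | refl => rfl
  | slide lam lam' X T' hne hX h ih =>
    obtain ⟨ν', hs⟩ := h.exists_isSlide hT hR hX
    rw [hs.exists_Kjdt_label_iff, ih]

/-- Every tableau of the right shape is a rectification of a tableau whose outer shape is a
rectangle. -/
theorem exists_reach_eq {K : Filling} (hK : K ∈ INC (outerShape a b A B ⊥) ⊥) :
    ∃ T ∈ INC (rectangle (a + A) (b + B)) (rectangle a b), Reach (rectangle a b) T ⊥ K := by
  have hR := rectangle_le_rectangle a b A B
  let N := maxLabel K
  let E := {K | K ∈ INC (outerShape a b A B ⊥) ⊥ ∧ ∀ x v, K x = Box.label v → v ≤ N}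
  have : Finite E := finite_INC_le _ _ N
  -- Rotating and then rectifying maps E to itself, because rectification preserves the set of
  -- labels.
  have hex : ∀ K : E, ∃ K' : E, Reach (rectangle a b) (rotated a b A B N K) ⊥ K' := by
    rintro ⟨K, hK, hN⟩
    obtain ⟨h1, h2⟩ := rotated_mem hK hN
    obtain ⟨K', hK'⟩ := exists_reach (rotated a b A B N K) (R := rectangle a b) bot_le
    refine ⟨⟨K', (hK'.mem_INC_outerShape h1).1, fun x v hx => ?_⟩, hK'⟩
    obtain ⟨y, hy⟩ := (hK'.exists_label_iff h1 hR v).1 ⟨x, hx⟩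
    exact h2 y v hy
  choose f hf using hex
  have hinj : Function.Injective f := by
    rintro ⟨K₁, h₁, n₁⟩ ⟨K₂, h₂, n₂⟩ h
    have e₁ := hf ⟨K₁, h₁, n₁⟩
    rw [h] at e₁
    exact Subtype.ext (rotated_injOn h₁ n₁ h₂ n₂ (rectification_injective (rotated_mem h₁ n₁).1
      (rotated_mem h₂ n₂).1 e₁ (hf ⟨K₂, h₂, n₂⟩)))
  obtain ⟨K', hK'⟩ := Finite.surjective_of_injective hinj
    ⟨K, hK, fun x v hx => INC.le_maxLabel hK hx⟩
  have := hf K'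
  rw [hK'] at this
  exact ⟨_, (rotated_mem K'.2.1 K'.2.2).1, this⟩

end Rotation

/-! ### Gluing tableaux -/

open Classical in
/-- The filling that agrees with `T` on `ν` and with `K` elsewhere. -/
noncomputable def glue (ν : YoungDiagram) (T K : Filling) : Filling := fun c =>
  if c ∈ ν then T c else K c

section Glue

variable {Λ ν lam : YoungDiagram} {T K : Filling} {n : ℕ}

theorem glue_label_iff (hT : T ∈ INC ν lam) (hK : K ∈ INC Λ ν) {x : ℕ × ℕ} {v : ℕ} :
    glue ν T K x = Box.label v ↔ T x = Box.label v ∨ K x = Box.label v := by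
  unfold glue
  split_ifs with h
  · rw [hK.2.1 x fun h' => h'.2 h]; simp
  · rw [hT.2.1 x fun h' => h h'.1]; simp

theorem glue_mem_INC (hT : T ∈ INC ν lam) (hK : K ∈ INC Λ ν) (h1 : lam ≤ ν) (h2 : ν ≤ Λ)
    (hTn : ∀ x v, T x = Box.label v → v ≤ n) (hKn : ∀ x v, K x = Box.label v → n < v) :
    glue ν T K ∈ INC Λ lam := by
  refine mem_INC_of_next ?_ ?_ ?_
  · intro c hc hcl
    by_cases hν : c ∈ ν
    · obtain ⟨v, hv, hv'⟩ := hT.1 c hν hcl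
      exact ⟨v, hv, (glue_label_iff hT hK).2 (Or.inl hv')⟩
    · obtain ⟨v, hv, hv'⟩ := hK.1 c hc hν
      exact ⟨v, hv, (glue_label_iff hT hK).2 (Or.inr hv')⟩
  · intro c hc
    unfold glue
    split_ifs with h
    · exact hT.2.1 c fun h' => hc ⟨h2 h'.1, h'.2⟩
    · exact hK.2.1 c fun h' => hc ⟨h'.1, fun h'' => h (h1 h'')⟩
  · intro c d p q hcd hp hq
    rw [glue_label_iff hT hK] at hp hq
    rcases hp with hp | hp <;> rcases hq with hq | hq
    · exact INC.lt hT hcd hp hq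
    · exact (hTn _ _ hp).trans_lt (hKn _ _ hq)
    · exact absurd (hcd.mem ((INC.label_iff hT).1 ⟨_, hq⟩).1) ((INC.label_iff hK).1 ⟨_, hp⟩).2
    · exact INC.lt hK hcd hp hq

theorem glue_label_gt (hT : T ∈ INC ν lam) (hK : K ∈ INC Λ ν)
    (hTn : ∀ x v, T x = Box.label v → v ≤ n) {x : ℕ × ℕ} {v : ℕ} (hv : n < v) :
    glue ν T K x = Box.label v ↔ K x = Box.label v := by
  rw [glue_label_iff hT hK]
  exact or_iff_right fun h => by have := hTn _ _ h; omega

theorem keep_glue (hT : T ∈ INC ν lam) (hK : K ∈ INC Λ ν)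
    (hTn : ∀ x v, T x = Box.label v → v ≤ n) (hKn : ∀ x v, K x = Box.label v → n < v) :
    keep (Set.Iic n) (glue ν T K) = T := by
  funext x
  refine Box.ext_symbols ?_ fun v => ?_
  · rw [keep_eq_bullet]
    refine iff_of_false ?_ (INC.ne_bullet hT x)
    unfold glue
    split_ifs
    exacts [INC.ne_bullet hT x, INC.ne_bullet hK x]
  · rw [keep_eq_label, glue_label_iff hT hK, Set.mem_Iic]
    constructor
    · rintro ⟨h1, h2 | h2⟩
      · exact h2
      · have := hKn _ _ h2; omega
    · exact fun h => ⟨hTn _ _ h, Or.inl h⟩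

/-- The labels above `n` of a tableau form a tableau outside the shape of the other labels. -/
theorem keep_Ioi_mem_INC (hK : K ∈ INC Λ lam) (hle : lam ≤ Λ)
    (hT : keep (Set.Iic n) K ∈ INC ν lam) (hlam : lam ≤ ν) :
    keep (Set.Ioi n) K ∈ INC Λ ν ∧ ν ≤ Λ := by
  have hν : ∀ c, c ∈ ν → c ∉ lam → ∃ v ≤ n, K c = Box.label v := fun c hc hcl => by
    obtain ⟨v, -, hv⟩ := hT.1 c hc hcl
    exact ⟨v, (keep_eq_label.1 hv)⟩
  refine ⟨mem_INC_of_next ?_ ?_ ?_, fun c hc => ?_⟩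
  · intro c hc hcν
    obtain ⟨v, hv, hv'⟩ := hK.1 c hc fun h => hcν (hlam h)
    refine ⟨v, hv, keep_eq_label.2 ⟨?_, hv'⟩⟩
    by_contra hvn
    exact hcν ((INC.label_iff hT).1 ⟨v, keep_eq_label.2 ⟨Set.mem_Iic.2 (not_lt.1 hvn), hv'⟩⟩).1
  · intro c hc
    match hs : keep (Set.Ioi n) K c with
    | Box.empty => rfl
    | Box.bullet => exact absurd (keep_eq_bullet.1 hs) (INC.ne_bullet hK c)
    | Box.label v =>
      obtain ⟨h1, h2⟩ := keep_eq_label.1 hs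
      have h3 := (INC.label_iff hK).1 ⟨v, h2⟩
      refine absurd ⟨h3.1, fun h4 => ?_⟩ hc
      obtain ⟨w, hw, hw'⟩ := hν c h4 h3.2
      rw [h2] at hw'
      cases hw'
      exact absurd hw (not_le.2 h1)
  · intro c d p q hcd hp hq
    exact INC.lt hK hcd (keep_eq_label.1 hp).2 (keep_eq_label.1 hq).2
  · by_cases hcl : c ∈ lam
    · exact hle hcl
    · obtain ⟨v, -, hv⟩ := hν c hc hcl
      exact ((INC.label_iff hK).1 ⟨v, hv⟩).1

end Glue

/-- Labels n + 1 + i + j increase along rows and columns. Only the bound matters: one filler serves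
all T. -/
theorem exists_filler (Λ ν : YoungDiagram) (n : ℕ) :
    ∃ F ∈ INC Λ ν, ∀ x v, F x = Box.label v → n < v := by
  classical
  refine ⟨fun c => if c ∈ Λ ∧ c ∉ ν then Box.label (n + 1 + c.1 + c.2) else Box.empty,
    mem_INC_of_next ?_ ?_ ?_, ?_⟩
  · intro c h1 h2
    exact ⟨n + 1 + c.1 + c.2, by omega, if_pos ⟨h1, h2⟩⟩
  · intro c hc
    exact if_neg hc
  · intro c d p q hcd hp hq
    split_ifs at hp hq
    simp only [Box.label.injEq] at hp hq
    rcases hcd with rfl | rfl <;> simp at hq <;> omega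
  · intro x v hx
    dsimp only at hx
    split_ifs at hx
    simp only [Box.label.injEq] at hx
    omega

/-! ### Comparing the fibres of rectification -/

section Counting

variable {a b A B n : ℕ} {ν μ : YoungDiagram} {C C' F : Filling}

/-- Replacing `C` by `C'` in the rectification of an extension of `T`. -/
theorem exists_partner (hR : rectangle a b ≤ ν) (hν : ν ≤ rectangle (a + A) (b + B))
    (hC : C ∈ INC μ ⊥) (hC' : C' ∈ INC μ ⊥) (hCn : ∀ x v, C x = Box.label v → v ≤ n)
    (hCn' : ∀ x v, C' x = Box.label v → v ≤ n)
    (hF : F ∈ INC (rectangle (a + A) (b + B)) ν) (hFn : ∀ x v, F x = Box.label v → n < v)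
    {T : Filling} (hT : T ∈ INC ν (rectangle a b)) (hTC : KRectifiesTo (rectangle a b) T C) :
    ∃ S K, S ∈ INC (rectangle (a + A) (b + B)) (rectangle a b) ∧
      K ∈ INC (outerShape a b A B ⊥) ⊥ ∧
      keep (Set.Iic n) S ∈ INC ν (rectangle a b) ∧
      KRectifiesTo (rectangle a b) (keep (Set.Iic n) S) C' ∧
      (∀ x v, n < v → (S x = Box.label v ↔ F x = Box.label v)) ∧
      keep (Set.Iic n) K = C ∧ Reach (rectangle a b) (glue ν T F) ⊥ K ∧
      Reach (rectangle a b) S ⊥ (glue μ C' (keep (Set.Ioi n) K)) := by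
  have hRL := rectangle_le_rectangle a b A B
  have hTn : ∀ x v, T x = Box.label v → v ≤ n := fun x v hx => by
    obtain ⟨y, hy⟩ := (hTC.exists_label_iff hT hR v).2 ⟨x, hx⟩
    exact hCn y v hy
  have hT' := glue_mem_INC hT hF hR hν hTn hFn
  obtain ⟨K, hK⟩ := exists_KRectifiesTo (rectangle a b) (glue ν T F)
  have hK' := hK.keep hT' hRL n
  rw [keep_glue hT hF hTn hFn] at hK'
  -- The small labels of K form the rectification of T, which is C; so the large ones fill the
  -- complement of μ.
  have hKC := KRectifiesTo_unique hT hR hK' hTC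
  have hKr := (KRectifiesTo_iff_reach hT' hRL).1 hK
  have hKi := (hKr.mem_INC_outerShape hT').1
  obtain ⟨hQ, hμ⟩ := keep_Ioi_mem_INC hKi bot_le (hKC.symm ▸ hC) bot_le
  have hQn : ∀ x v, keep (Set.Ioi n) K x = Box.label v → n < v := fun x v hx =>
    (keep_eq_label.1 hx).1
  -- C' has the same shape μ as C and also only small labels, so it fits in the place of C.
  have hK₂ := glue_mem_INC hC' hQ bot_le hμ hCn' hQn
  obtain ⟨S, hS, hSr⟩ := exists_reach_eq hK₂
  have hgt : ∀ x v, n < v → (S x = Box.label v ↔ F x = Box.label v) := by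
    intro x v hv
    rw [← glue_label_gt hT hF hTn hv]
    refine label_iff_of_reach (N := max n (max (maxLabel K)
      (maxLabel (glue μ C' (keep (Set.Ioi n) K))))) (le_max_left _ _) hS hT' hSr hKr
      (fun x v hx => ?_) (fun x v hx => ?_) (fun x v hv => ?_) x v hv
    · have := INC.le_maxLabel hK₂ hx
      simp [this]
    · have := INC.le_maxLabel hKi hx
      simp [this]
    · rw [glue_label_gt hC' hQ hCn' hv, keep_eq_label]
      exact ⟨fun h => h.2, fun h => ⟨hv, h⟩⟩
  have hSC := ((KRectifiesTo_iff_reach hS hRL).2 hSr).keep hS hRL n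
  rw [keep_glue hC' hQ hCn' hQn] at hSC
  -- The large labels of S are those of F and occupy exactly the boxes outside ν, which leaves ν/R
  -- for the small ones.
  refine ⟨S, K, hS, hKi, mem_INC_of_next ?_ ?_ ?_, hSC, hgt, hKC, hKr, hSr⟩
  · intro c hc hcR
    obtain ⟨v, hv, hv'⟩ := hS.1 c (hν hc) hcR
    refine ⟨v, hv, keep_eq_label.2 ⟨?_, hv'⟩⟩
    by_contra hvn
    exact ((INC.label_iff hF).1 ⟨v, (hgt c v (not_le.1 hvn)).1 hv'⟩).2 hc
  · intro c hc
    match hs : keep (Set.Iic n) S c with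
    | Box.empty => rfl
    | Box.bullet => exact absurd (keep_eq_bullet.1 hs) (INC.ne_bullet hS c)
    | Box.label v =>
      obtain ⟨h1, h2⟩ := keep_eq_label.1 hs
      have h3 := (INC.label_iff hS).1 ⟨v, h2⟩
      obtain ⟨w, hw⟩ := (INC.label_iff hF).2 ⟨h3.1, fun h4 => hc ⟨h4, h3.2⟩⟩
      have h5 := hFn _ _ hw
      rw [← hgt c w h5, h2] at hw
      cases hw
      exact absurd h5 (not_lt.2 h1)
  · intro c d p q hcd hp hq
    exact INC.lt hS hcd (keep_eq_label.1 hp).2 (keep_eq_label.1 hq).2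

theorem exists_bounding_rectangle (a b : ℕ) (ν : YoungDiagram) :
    ∃ A B, ν ≤ rectangle (a + A) (b + B) := by
  obtain ⟨A, hA⟩ := (ν.cells.finite_toSet.image Prod.fst).bddAbove
  obtain ⟨B, hB⟩ := (ν.cells.finite_toSet.image Prod.snd).bddAbove
  refine ⟨A + 1, B + 1, fun c hc => ?_⟩
  have h1 := hA ⟨c, hc, rfl⟩
  have h2 := hB ⟨c, hc, rfl⟩
  rw [mem_rectangle]
  omega

/-- The map sending T to the small labels of its partner S can be inverted: S is recovered by adding
F, then the large labels of K from the rectification of S, then K by restoring C, and finally T by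
undoing the rectification of its extension. -/
theorem encard_le_encard (hR : rectangle a b ≤ ν) (hC : C ∈ INC μ ⊥) (hC' : C' ∈ INC μ ⊥) :
    {T | T ∈ INC ν (rectangle a b) ∧ KRectifiesTo (rectangle a b) T C}.encard ≤
      {T | T ∈ INC ν (rectangle a b) ∧ KRectifiesTo (rectangle a b) T C'}.encard := by
  obtain ⟨A, B, hν⟩ := exists_bounding_rectangle a b ν
  have hRL := rectangle_le_rectangle a b A B
  let n := max (maxLabel C) (maxLabel C')
  have hCn : ∀ x v, C x = Box.label v → v ≤ n := fun x v hx =>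
    (INC.le_maxLabel hC hx).trans (le_max_left _ _)
  have hCn' : ∀ x v, C' x = Box.label v → v ≤ n := fun x v hx =>
    (INC.le_maxLabel hC' hx).trans (le_max_right _ _)
  obtain ⟨F, hF, hFn⟩ := exists_filler (rectangle (a + A) (b + B)) ν n
  have hex : ∀ T, ∃ S K, T ∈ INC ν (rectangle a b) ∧ KRectifiesTo (rectangle a b) T C → _ :=
    fun T => by
      by_cases h : T ∈ INC ν (rectangle a b) ∧ KRectifiesTo (rectangle a b) T C
      · obtain ⟨S, K, h'⟩ := exists_partner hR hν hC hC' hCn hCn' hF hFn h.1 h.2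
        exact ⟨S, K, fun _ => h'⟩
      -- A dummy value outside the fibre of C, where nothing is claimed.
      · exact ⟨T, T, fun h' => absurd h' h⟩
  choose S K h using hex
  refine Set.encard_le_encard_of_injOn (f := fun T => keep (Set.Iic n) (S T)) ?_ ?_
  · intro T hT
    exact ⟨(h T hT).2.2.1, (h T hT).2.2.2.1⟩
  · intro T₁ hT₁ T₂ hT₂ heq
    dsimp only at heq
    obtain ⟨s₁, k₁, -, -, g₁, c₁, r₁, q₁⟩ := h T₁ hT₁
    obtain ⟨s₂, k₂, -, -, g₂, c₂, r₂, q₂⟩ := h T₂ hT₂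
    have hS : S T₁ = S T₂ := INC.ext s₁ s₂ fun x v => by
      by_cases hv : n < v
      · rw [g₁ x v hv, g₂ x v hv]
      · have := congrFun heq x
        have e₁ := keep_eq_label (S := Set.Iic n) (s := S T₁) (c := x) (v := v)
        have e₂ := keep_eq_label (S := Set.Iic n) (s := S T₂) (c := x) (v := v)
        rw [this, e₂] at e₁
        have hv' : v ∈ Set.Iic n := not_lt.1 hv
        simpa [hv'] using e₁.symm
    have hle₁ := keep_Ioi_mem_INC k₁ bot_le (c₁.symm ▸ hC) bot_le
    have hle₂ := keep_Ioi_mem_INC k₂ bot_le (c₂.symm ▸ hC) bot_le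
    rw [hS] at q₁
    have hglue := Reach.unique s₂ hRL q₁ q₂
    -- The large labels of K are visible in the rectification of S, and the small ones are those of
    -- C in both cases.
    have hK : K T₁ = K T₂ := INC.ext k₁ k₂ fun x v => by
      by_cases hv : n < v
      · have e₁ := glue_label_gt hC' hle₁.1 hCn' hv (x := x)
        have e₂ := glue_label_gt hC' hle₂.1 hCn' hv (x := x)
        rw [hglue, e₂, keep_eq_label, keep_eq_label] at e₁
        have hv' : v ∈ Set.Ioi n := hv
        simpa [hv'] using e₁.symm
      · have e₁ := keep_eq_label (S := Set.Iic n) (s := K T₁) (c := x) (v := v)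
        have e₂ := keep_eq_label (S := Set.Iic n) (s := K T₂) (c := x) (v := v)
        rw [c₁, ← c₂, e₂] at e₁
        have hv' : v ∈ Set.Iic n := not_lt.1 hv
        simpa [hv'] using e₁.symm
    have hTn : ∀ T, T ∈ INC ν (rectangle a b) → KRectifiesTo (rectangle a b) T C →
        ∀ x v, T x = Box.label v → v ≤ n := fun T hT hTC x v hx => by
      obtain ⟨y, hy⟩ := (hTC.exists_label_iff hT hR v).2 ⟨x, hx⟩
      exact hCn y v hy
    have n₁ := hTn T₁ hT₁.1 hT₁.2
    have n₂ := hTn T₂ hT₂.1 hT₂.2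
    rw [hK] at r₁
    have := rectification_injective (glue_mem_INC hT₁.1 hF hR hν n₁ hFn)
      (glue_mem_INC hT₂.1 hF hR hν n₂ hFn) r₁ r₂
    rw [← keep_glue hT₁.1 hF n₁ hFn, this, keep_glue hT₂.1 hF n₂ hFn]

theorem finite_rectifying (hR : rectangle a b ≤ ν) (hC : C ∈ INC μ ⊥) :
    {T | T ∈ INC ν (rectangle a b) ∧ KRectifiesTo (rectangle a b) T C}.Finite := by
  refine (finite_INC_le ν (rectangle a b) (maxLabel C)).subset ?_
  rintro T ⟨hT, hTC⟩
  refine ⟨hT, fun x v hx => ?_⟩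
  obtain ⟨y, hy⟩ := (hTC.exists_label_iff hT hR v).2 ⟨x, hx⟩
  exact INC.le_maxLabel hC hy

end Counting

theorem theorem1p1 (a b : ℕ) (ν : YoungDiagram) (hR : rectangle a b ≤ ν) :
    -- all rectification orders lead from `T` to one and the same straight-shape tableau `K`
    (∀ T ∈ INC ν (rectangle a b), ∃ μ : YoungDiagram, ∃ K ∈ INC μ ⊥,
      ∀ C : Filling, KRectifiesTo (rectangle a b) T C ↔ C = K) ∧
    -- the number of `T` that rectify to `C ∈ INC(μ)` is finite and the same for every `C`
    (∀ μ : YoungDiagram, ∃ m : ℕ, ∀ C ∈ INC μ ⊥,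
      {T | T ∈ INC ν (rectangle a b) ∧ KRectifiesTo (rectangle a b) T C}.encard = (m : ℕ∞)) := by
  refine ⟨fun T hT => ?_, fun μ => ?_⟩
  · obtain ⟨K, hK⟩ := exists_KRectifiesTo (rectangle a b) T
    obtain ⟨μ, hμ, -⟩ := (Reach.of_KRectifiesTo hK .refl).exists_mem_INC hT hR
    exact ⟨μ, K, hμ, fun C => ⟨fun h => KRectifiesTo_unique hT hR h hK, fun h => h ▸ hK⟩⟩
  · by_cases hne : (INC μ ⊥).Nonempty
    · obtain ⟨C₀, hC₀⟩ := hne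
      obtain ⟨m, hm⟩ := (Set.encard_ne_top_iff.2 (finite_rectifying hR hC₀) |>
        ENat.ne_top_iff_exists.1)
      exact ⟨m, fun C hC => hm ▸ le_antisymm (encard_le_encard hR hC hC₀)
        (encard_le_encard hR hC₀ hC)⟩
    · exact ⟨0, fun C hC => absurd ⟨C, hC⟩ hne⟩
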